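/- Let $k$ be an algebraically closed field, $G$ an affine algebraic group over $k$ (a reduced affine $k$-group scheme of finite type), $N$ a closed normal $k$-subgroup scheme of $G$ (not necessarily reduced), and $Q$ a finite dimensional rational $N$-module given by $\rho:N\to GL_k(Q)$. Let $V\subseteq Q$ be a subspace with a rational $G$-module structure whose restriction to $N$ agrees with the action of $N$ on $Q$, and assume $\operatorname{soc}^N Q\subseteq V$. A *structure map* for $(Q,V)$ is a morphism of $k$-schemes $\alpha:G\to GL_k(Q)$ such that, for all commutative $k$-algebras $S$, $g\in G(S)$, $n\in N(S)$, $v\in V_S=V\otimes S$, $$\alpha(1)=1,\quad \alpha(g)\rho(n)=\rho(gng^{-1})\alpha(g),\quad \alpha(gn)=\alpha(g)\rho(n),\quad \alpha(g)v=gv .$$ Assume $(Q,V)$ is strongly $G$-stable, i.e. a structure map exists. Let $J_V\subseteq\operatorname{End}_N(Q)$ be the annihilator of $V$, and let $U=1+J_V$, the closed subgroup of $GL_k(Q)$ with $U(S)=1+J_V\otimes S$. For a structure map $\alpha$ let $G^\diamond_\alpha$ be the $k$-group with $G^\diamond_\alpha(S)=U(S)\times G(S)$ and multiplication $$(x,g)(y,h)=\bigl(x\cdot\alpha(g)y\alpha(g)^{-1}\cdot\alpha(g)\alpha(h)\alpha(gh)^{-1},\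 gh\bigr),$$ and let $\rho^\diamond_\alpha:G^\diamond_\alpha\to GL_k(Q)$, $(x,g)\mapsto x\alpha(g)$, which defines an action of $G^\diamond_\alpha$ on $Q$. Then $G^\diamond_\alpha$ is an affine algebraic group, $\rho^\diamond_\alpha$ is a homomorphism, and the following hold. 1. The image $G^*$ of $\rho^\diamond_\alpha$ (the smallest closed subgroup scheme of $GL_k(Q)$ through which $\rho^\diamond_\alpha$ factors) is an affine algebraic group containing $U$, with $G^*(k)=U(k)\alpha(G(k))$, and it does not depend on the choice of the structure map $\alpha$. 2. $U$ is normal in $G^*$ and the quotient $G^*/U$ exists as an affine algebraic group; the map $G\to G^*/U$ sending $g$ to the image of $\alpha(g)$ is a homomorphism of algebraic groups and does not depend on $\alpha$. 3. For every $\alpha$ the square $$\begin{array}{ccc} G^\diamond_\alpha & \longrightarrow & G\\ \downarrow & & \downarrow\\ G^* & \longrightarrow & G^*/U\end{array}$$ is a pull-back diagram in the category of affine algebraic groups (indeed, of $k$-group functors), where the top map is $(x,g)\mapsto g$, the left map is given by $\rho^\diamond_\alpha$, the right map is the one in 2, and the bottom map is the quotient map. 4. For any two structure maps $\alpha,\alpha'$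 there is an isomorphism of algebraic groups $G^\diamond_\alpha\cong G^\diamond_{\alpha'}$ compatible with the actions on $Q$ and with the projections to $G$. -/

import Mathlib

open CategoryTheory
open scoped TensorProduct

universe u

/-- A `k`-group functor: a functor from commutative `k`-algebras to groups. -/
abbrev KGroup (k : Type u) [Field k] := CommAlgCat.{u} k ⥤ GrpCat.{u}

namespace KGroup

variable {k : Type u} [Field k]

/-- `F` is an affine algebraic group over `k` (intended for `k` algebraically closed): the
underlying functor of points is the functor `A ⟶ -` of a reduced, finitely generated, commutative
`k`-algebra `A`. -/
def IsAffineAlgebraic (F : KGroup k) : Prop :=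
  ∃ A : CommAlgCat.{u} k, Algebra.FiniteType k A ∧ IsReduced A ∧
    Nonempty ((F ⋙ forget GrpCat.{u}).CorepresentableBy A)

/-- A regular function on `F`: a morphism of `k`-functors from `F` to the affine line
`S ↦ S`. -/
@[ext]
structure RegularFunction (F : KGroup k) where
  toFun : ∀ S : CommAlgCat.{u} k, F.obj S → S
  naturality : ∀ {S T : CommAlgCat.{u} k} (f : S ⟶ T) (x : F.obj S),
    toFun T ((F.map f).hom x) = f.hom (toFun S x)

/-- A subgroup functor of a `k`-group functor. -/
@[ext]
structure SubgroupFunctor (F : KGroup k) where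
  pts : ∀ S : CommAlgCat.{u} k, Subgroup (F.obj S)
  map_mem : ∀ {S T : CommAlgCat.{u} k} (f : S ⟶ T) (x : F.obj S),
    x ∈ pts S → (F.map f).hom x ∈ pts T

namespace SubgroupFunctor

variable {F : KGroup k}

/-- A subgroup functor regarded as a `k`-group functor. -/
def toKGroup (Z : SubgroupFunctor F) : KGroup k where
  obj S := GrpCat.of (Z.pts S)
  map {S T} f := GrpCat.ofHom
    (((F.map f).hom.comp (Z.pts S).subtype).codRestrict (Z.pts T)
      fun x => Z.map_mem f x.1 x.2)
  map_id S := by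
    refine GrpCat.ext fun x => Subtype.ext ?_
    change (F.map (𝟙 S)).hom x.1 = x.1
    rw [F.map_id]; rfl
  map_comp f g := by
    refine GrpCat.ext fun x => Subtype.ext ?_
    change (F.map (f ≫ g)).hom x.1 = (F.map g).hom ((F.map f).hom x.1)
    rw [F.map_comp]; rfl

/-- The inclusion of a subgroup functor. -/
def ι (Z : SubgroupFunctor F) : Z.toKGroup ⟶ F where
  app S := GrpCat.ofHom (Z.pts S).subtype
  naturality _ _ _ := rfl

/-- `Z` is contained in `Z'`. -/
def Le (Z Z' : SubgroupFunctor F) : Prop := ∀ S, Z.pts S ≤ Z'.pts S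

/-- `Z` is closed: it is the common zero locus of some set of regular functions. For `F`
representable this is the usual notion of a closed `k`-subgroup scheme (not necessarily
reduced). -/
def IsClosed (Z : SubgroupFunctor F) : Prop :=
  ∃ I : Set (RegularFunction F), ∀ (S : CommAlgCat.{u} k) (x : F.obj S),
    x ∈ Z.pts S ↔ ∀ f ∈ I, f.toFun S x = 0

/-- `Z` is normal. -/
def IsNormal (Z : SubgroupFunctor F) : Prop := ∀ S, (Z.pts S).Normal

/-- For subgroup functors `U`, `Z` of `F`, the intersection of `U` with `Z` as a subgroup functor
of `Z`. It is used only when `U` is contained in `Z`. -/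
def restrict (U Z : SubgroupFunctor F) : SubgroupFunctor Z.toKGroup where
  pts S := (U.pts S).subgroupOf (Z.pts S)
  map_mem f x hx := U.map_mem f x.1 hx

/-- The image of a homomorphism `f : F' ⟶ F`: the smallest closed subgroup of `F` through
which `f` factors. -/
def image {F' F : KGroup k} (f : F' ⟶ F) : SubgroupFunctor F where
  pts S := ⨅ Z : {Z : SubgroupFunctor F // Z.IsClosed ∧
    ∀ (T : CommAlgCat.{u} k) (x : F'.obj T), (f.app T).hom x ∈ Z.pts T}, Z.1.pts S
  map_mem g x hx := by
    rw [Subgroup.mem_iInf] at hx ⊢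
    exact fun Z => Z.1.map_mem g x (hx Z)

end SubgroupFunctor

/-- `q : F ⟶ H` is a quotient map of affine group schemes with kernel `U`, so that `H` is the
quotient `F / U`. As usual for affine group schemes over a field, a quotient map is a homomorphism
whose comorphism on coordinate rings is injective (equivalently, faithfully flat). -/
structure IsQuotient {F H : KGroup k} (q : F ⟶ H) (U : SubgroupFunctor F) : Prop where
  ker_eq : ∀ (S : CommAlgCat.{u} k) (x : F.obj S), (q.app S).hom x = 1 ↔ x ∈ U.pts S
  comorphism_injective : ∀ f f' : RegularFunction H,
    (∀ (S : CommAlgCat.{u} k) (x : F.obj S),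
      f.toFun S ((q.app S).hom x) = f'.toFun S ((q.app S).hom x)) → f = f'

/-! ### General linear groups and rational modules -/

section GeneralLinear

variable (k) (Q : Type u) [AddCommGroup Q] [Module k Q]

/-- The functor `GL_k(Q)`, with `S`-points the units of `S ⊗ End_k(Q)`; for `Q` finite dimensional
`S ⊗ End_k(Q)` is `End_S(S ⊗ Q)`, see `act_bijective`. -/
noncomputable def GenLin : KGroup k where
  obj S := GrpCat.of (S ⊗[k] Module.End k Q)ˣ
  map f := GrpCat.ofHom
    (Units.map (Algebra.TensorProduct.map f.hom (AlgHom.id k (Module.End k Q)) : _ →* _))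
  map_id S := by
    refine GrpCat.ext fun x => Units.ext ?_
    change Algebra.TensorProduct.map (AlgHom.id k S) (AlgHom.id k (Module.End k Q)) x.1 = x.1
    simp
  map_comp f g := by
    refine GrpCat.ext fun x => Units.ext ?_
    change Algebra.TensorProduct.map (g.hom.comp f.hom) (AlgHom.id k (Module.End k Q)) x.1 =
      Algebra.TensorProduct.map g.hom (AlgHom.id k (Module.End k Q))
        (Algebra.TensorProduct.map f.hom (AlgHom.id k (Module.End k Q)) x.1)
    rw [← AlgHom.comp_apply, ← Algebra.TensorProduct.map_comp]
    rfl

variable {k Q}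

/-- The element of `S ⊗ End_k(Q)` underlying an `S`-point of `GL_k(Q)`. -/
noncomputable def val {S : CommAlgCat.{u} k} (y : (GenLin k Q).obj S) : S ⊗[k] Module.End k Q :=
  Units.val (α := S ⊗[k] Module.End k Q) y

/-- The action of `S ⊗ End_k(Q)` on `S ⊗ Q`. -/
noncomputable def act {S : CommAlgCat.{u} k} :
    S ⊗[k] Module.End k Q →ₐ[S] Module.End S (S ⊗[k] Q) :=
  LinearMap.tensorProductEnd k S Q

/-- For `Q` finite dimensional, `S ⊗ End_k(Q)` is `End_S(S ⊗ Q)`. -/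
lemma act_bijective [FiniteDimensional k Q] (S : CommAlgCat.{u} k) :
    Function.Bijective (act (Q := Q) (S := S)) := by
  have : Module.FinitePresentation k Q := Module.finitePresentation_of_finite k Q
  have h : IsBaseChange S (LinearMap.baseChangeHom k S Q Q) :=
    Module.FinitePresentation.isBaseChange_map k Q Q S
  have e : (act (Q := Q) (S := S)).toLinearMap = h.equiv.toLinearMap := by
    refine TensorProduct.AlgebraTensorModule.ext fun s φ => ?_
    rw [LinearEquiv.coe_coe, h.equiv_tmul]
    rfl
  have := h.equiv.bijective
  rw [← LinearEquiv.coe_coe, ← e] at this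
  exact this

/-- The inclusion `V_S → Q_S` for a subspace `V` of `Q`. -/
noncomputable abbrev incl (V : Submodule k Q) (S : CommAlgCat.{u} k) :
    S ⊗[k] V →ₗ[S] S ⊗[k] Q :=
  V.subtype.baseChange S

/-- Extension of scalars `S ⊗ End_k(Q) → T ⊗ End_k(Q)` along `f : S ⟶ T`. -/
noncomputable abbrev extend {S T : CommAlgCat.{u} k} (f : S ⟶ T) :
    S ⊗[k] Module.End k Q →ₐ[k] T ⊗[k] Module.End k Q :=
  Algebra.TensorProduct.map f.hom (AlgHom.id k (Module.End k Q))

end GeneralLinear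

section Stability

variable {G : KGroup k} {N : SubgroupFunctor G} {Q : Type u} [AddCommGroup Q] [Module k Q]

/-- The operator in `S ⊗ End_k(Q)` by which an `S`-point `n` of `N` acts. -/
noncomputable def op (ρ : N.toKGroup ⟶ GenLin k Q) {S : CommAlgCat.{u} k} (n : N.pts S) :
    S ⊗[k] Module.End k Q :=
  val ((ρ.app S).hom n)

/-- `W` is an `N`-submodule of the rational `N`-module `Q`. -/
def IsSubmodule (ρ : N.toKGroup ⟶ GenLin k Q) (W : Submodule k Q) : Prop :=
  ∀ (S : CommAlgCat.{u} k) (n : N.pts S), ∀ w ∈ W.baseChange S, act (op ρ n) w ∈ W.baseChange S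

/-- The `N`-socle of `Q`: the sum of its simple `N`-submodules. -/
def socle (ρ : N.toKGroup ⟶ GenLin k Q) : Submodule k Q :=
  sSup {W | IsSubmodule ρ W ∧ W ≠ ⊥ ∧ ∀ W' ≤ W, IsSubmodule ρ W' → W' = ⊥ ∨ W' = W}

/-- The subspace `V` of `Q`, with the rational `G`-module structure `σ`, is a `G`-submodule of
the `N`-module `Q`: the actions of `N` on `V` through `σ` and inside `Q` agree. -/
def IsGSubmodule (ρ : N.toKGroup ⟶ GenLin k Q) (V : Submodule k Q) (σ : G ⟶ GenLin k V) : Prop :=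
  ∀ (S : CommAlgCat.{u} k) (n : N.pts S) (v : S ⊗[k] V),
    act (op ρ n) (incl V S v) = incl V S (act (val ((σ.app S).hom n.1)) v)

/-- A structure map `α : G → GL_k(Q)` demonstrating the strong `G`-stability of the pair
`(Q, V)`: a morphism of `k`-functors (not of groups) with the listed properties. -/
structure StructureMap (hN : N.IsNormal) (ρ : N.toKGroup ⟶ GenLin k Q) (V : Submodule k Q)
    (σ : G ⟶ GenLin k V) where
  toFun : ∀ S : CommAlgCat.{u} k, G.obj S → (GenLin k Q).obj S
  naturality : ∀ {S T : CommAlgCat.{u} k} (f : S ⟶ T) (g : G.obj S),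
    toFun T ((G.map f).hom g) = ((GenLin k Q).map f).hom (toFun S g)
  map_one : ∀ S, toFun S 1 = 1
  conj : ∀ (S : CommAlgCat.{u} k) (g : G.obj S) (n : N.pts S),
    toFun S g * (ρ.app S).hom n =
      (ρ.app S).hom (⟨g * n.1 * g⁻¹, (hN S).conj_mem n.1 n.2 g⟩ : N.pts S) * toFun S g
  map_mul_right : ∀ (S : CommAlgCat.{u} k) (g : G.obj S) (n : N.pts S),
    toFun S (g * n.1) = toFun S g * (ρ.app S).hom n
  restrict : ∀ (S : CommAlgCat.{u} k) (g : G.obj S) (v : S ⊗[k] V),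
    act (val (toFun S g)) (incl V S v) = incl V S (act (val ((σ.app S).hom g)) v)

/-- `J_V`: the annihilator of `V` in `End_N(Q)`. -/
def annihilator (ρ : N.toKGroup ⟶ GenLin k Q) (V : Submodule k Q) :
    Submodule k (Module.End k Q) where
  carrier := {φ | (∀ (S : CommAlgCat.{u} k) (n : N.pts S),
      (1 ⊗ₜ[k] φ : S ⊗[k] Module.End k Q) * op ρ n = op ρ n * (1 ⊗ₜ[k] φ)) ∧ ∀ v ∈ V, φ v = 0}
  zero_mem' := by simp
  add_mem' := by
    rintro a b ⟨ha, ha'⟩ ⟨hb, hb'⟩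
    refine ⟨fun S n => ?_, fun v hv => by simp [ha' v hv, hb' v hv]⟩
    rw [TensorProduct.tmul_add, add_mul, mul_add, ha, hb]
  smul_mem' := by
    rintro c a ⟨ha, ha'⟩
    refine ⟨fun S n => ?_, fun v hv => by simp [ha' v hv]⟩
    rw [TensorProduct.tmul_smul, smul_mul_assoc, mul_smul_comm, ha]

lemma op_map (ρ : N.toKGroup ⟶ GenLin k Q) {S T : CommAlgCat.{u} k} (f : S ⟶ T) (n : N.pts S) :
    op ρ (⟨(G.map f).hom n.1, N.map_mem f n.1 n.2⟩ : N.pts T) = extend f (op ρ n) := by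
  have h := ConcreteCategory.congr_hom (ρ.naturality f) n
  exact congrArg val h

/-- The map `S ⊗ M → M` induced by a linear functional on `S`. -/
noncomputable def slice {S : Type u} [AddCommGroup S] [Module k S] (c : S →ₗ[k] k) (M : Type u)
    [AddCommGroup M] [Module k M] : S ⊗[k] M →ₗ[k] M :=
  (TensorProduct.lid k M).toLinearMap ∘ₗ c.rTensor M

@[simp] lemma slice_tmul {S : Type u} [AddCommGroup S] [Module k S] (c : S →ₗ[k] k) {M : Type u}
    [AddCommGroup M] [Module k M] (s : S) (m : M) : slice c M (s ⊗ₜ m) = c s • m := by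
  simp [slice]

@[simp] lemma act_tmul {S : CommAlgCat.{u} k} (s t : S) (φ : Module.End k Q) (v : Q) :
    act (s ⊗ₜ[k] φ) (t ⊗ₜ[k] v) = (s * t) ⊗ₜ[k] φ v := by
  rfl

lemma slice_act {S : CommAlgCat.{u} k} (c : S →ₗ[k] k) (x : S ⊗[k] Module.End k Q) (v : Q) :
    slice c Q (act x (1 ⊗ₜ[k] v)) = slice c (Module.End k Q) x v := by
  induction x with
  | zero => simp
  | add x y hx hy => simp only [map_add, LinearMap.add_apply, hx, hy]
  | tmul s φ => simp

lemma slice_comm {S T : CommAlgCat.{u} k} (c : S →ₗ[k] k) (x : S ⊗[k] Module.End k Q)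
    (y : T ⊗[k] Module.End k Q)
    (h : extend (CommAlgCat.ofHom Algebra.TensorProduct.includeLeft :
          S ⟶ CommAlgCat.of k (S ⊗[k] T)) x *
        extend (CommAlgCat.ofHom Algebra.TensorProduct.includeRight :
          T ⟶ CommAlgCat.of k (S ⊗[k] T)) y =
      extend (CommAlgCat.ofHom Algebra.TensorProduct.includeRight :
          T ⟶ CommAlgCat.of k (S ⊗[k] T)) y *
        extend (CommAlgCat.ofHom Algebra.TensorProduct.includeLeft :
          S ⟶ CommAlgCat.of k (S ⊗[k] T)) x) :
    (1 ⊗ₜ[k] slice c (Module.End k Q) x : T ⊗[k] Module.End k Q) * y =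
      y * (1 ⊗ₜ[k] slice c (Module.End k Q) x) := by
  have h' := congrArg ((slice c T).rTensor (Module.End k Q)) h
  have h1 : (slice c T).rTensor (Module.End k Q)
      (extend (CommAlgCat.ofHom Algebra.TensorProduct.includeLeft :
          S ⟶ CommAlgCat.of k (S ⊗[k] T)) x *
        extend (CommAlgCat.ofHom Algebra.TensorProduct.includeRight :
          T ⟶ CommAlgCat.of k (S ⊗[k] T)) y) =
      (1 ⊗ₜ[k] slice c (Module.End k Q) x : T ⊗[k] Module.End k Q) * y := by
    clear h h'
    induction x with
    | zero => simp
    | add x x' hx hx' => rw [map_add, add_mul, map_add, hx, hx', map_add, TensorProduct.tmul_add,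
        add_mul]
    | tmul s φ =>
      induction y with
      | zero => simp
      | add y y' hy hy' => rw [map_add, mul_add, map_add, hy, hy', mul_add]
      | tmul t ψ => simp [← TensorProduct.smul_tmul', smul_mul_assoc]
  have h2 : (slice c T).rTensor (Module.End k Q)
      (extend (CommAlgCat.ofHom Algebra.TensorProduct.includeRight :
          T ⟶ CommAlgCat.of k (S ⊗[k] T)) y *
        extend (CommAlgCat.ofHom Algebra.TensorProduct.includeLeft :
          S ⟶ CommAlgCat.of k (S ⊗[k] T)) x) =
      y * (1 ⊗ₜ[k] slice c (Module.End k Q) x : T ⊗[k] Module.End k Q) := by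
    clear h h' h1
    induction x with
    | zero => simp
    | add x x' hx hx' => rw [map_add, mul_add, map_add, hx, hx', map_add, TensorProduct.tmul_add,
        mul_add]
    | tmul s φ =>
      induction y with
      | zero => simp
      | add y y' hy hy' => rw [map_add, add_mul, map_add, hy, hy', add_mul]
      | tmul t ψ => simp [← TensorProduct.smul_tmul', mul_smul_comm]
  rw [← h1, h', h2]

lemma mem_annihilator_baseChange (ρ : N.toKGroup ⟶ GenLin k Q) (V : Submodule k Q)
    {S : CommAlgCat.{u} k} (x : S ⊗[k] Module.End k Q) :
    x ∈ (annihilator ρ V).baseChange S ↔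
      (∀ (T : CommAlgCat.{u} k) (f : S ⟶ T) (n : N.pts T),
        extend f x * op ρ n = op ρ n * extend f x) ∧ ∀ v ∈ V, act x (1 ⊗ₜ[k] v) = 0 := by
  constructor
  · rintro ⟨z, rfl⟩
    induction z with
    | zero => simp
    | add z w hz hw =>
      refine ⟨fun T f n => ?_, fun v hv => ?_⟩
      · rw [map_add, map_add, add_mul, mul_add, hz.1, hw.1]
      · rw [map_add, map_add, LinearMap.add_apply, hz.2 v hv, hw.2 v hv, add_zero]
    | tmul s φ =>
      refine ⟨fun T f n => ?_, fun v hv => ?_⟩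
      · have h : extend f ((annihilator ρ V).subtype.baseChange S (s ⊗ₜ[k] φ)) =
            f.hom s • (1 ⊗ₜ[k] φ.1 : T ⊗[k] Module.End k Q) := by
          simp [TensorProduct.smul_tmul']
        rw [h, smul_mul_assoc, mul_smul_comm, φ.2.1]
      · simp [φ.2.2 v hv]
  · rintro ⟨h1, h2⟩
    classical
    let b := Module.Basis.ofVectorSpace k S
    obtain ⟨a, ha⟩ := (TensorProduct.equivFinsuppOfBasisLeft (N := Module.End k Q) b).symm.surjective x
    have key : ∀ i, slice (b.coord i) (Module.End k Q) x = a i := by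
      intro i
      rw [← ha, TensorProduct.equivFinsuppOfBasisLeft_symm_apply, Finsupp.sum, map_sum]
      simp only [slice_tmul, Module.Basis.coord_apply, Module.Basis.repr_self]
      rw [Finset.sum_eq_single i]
      · simp
      · intro j _ hj; simp [Finsupp.single_eq_of_ne hj.symm]
      · intro hi; simpa using hi
    rw [← ha, TensorProduct.equivFinsuppOfBasisLeft_symm_apply]
    refine Submodule.sum_mem _ fun i _ => Submodule.tmul_mem_baseChange_of_mem _ ?_
    rw [← key i]
    refine ⟨fun T n => ?_, fun v hv => ?_⟩
    · refine slice_comm _ x (op ρ n) ?_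
      rw [← op_map]
      exact h1 _ _ _
    · rw [← slice_act, h2 v hv, map_zero]

lemma extend_mem_annihilator (ρ : N.toKGroup ⟶ GenLin k Q) (V : Submodule k Q)
    {S T : CommAlgCat.{u} k} (f : S ⟶ T) {x : S ⊗[k] Module.End k Q}
    (hx : x ∈ (annihilator ρ V).baseChange S) : extend f x ∈ (annihilator ρ V).baseChange T := by
  obtain ⟨z, rfl⟩ := hx
  induction z with
  | zero => simp
  | add z w hz hw => rw [map_add, map_add]; exact add_mem hz hw
  | tmul s φ => exact Submodule.tmul_mem_baseChange_of_mem _ φ.2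

lemma incl_eq_of (V : Submodule k Q) {S : CommAlgCat.{u} k} {x : S ⊗[k] Module.End k Q}
    (h : ∀ v ∈ V, act x (1 ⊗ₜ[k] v) = 0) (v : S ⊗[k] V) : act x (incl V S v) = 0 := by
  induction v with
  | zero => simp
  | add v w hv hw => rw [map_add, map_add, hv, hw, add_zero]
  | tmul s v =>
    have : incl V S (s ⊗ₜ[k] v) = s • ((1 : S) ⊗ₜ[k] (v : Q)) := by
      simp [TensorProduct.smul_tmul']
    rw [this, map_smul, h v v.2, smul_zero]

/-- The conjugate `g n g⁻¹` of an `S`-point `n` of a normal subgroup. -/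
def conjPt (hN : N.IsNormal) {S : CommAlgCat.{u} k} (g : G.obj S) (n : N.pts S) : N.pts S :=
  ⟨g * n.1 * g⁻¹, (hN S).conj_mem n.1 n.2 g⟩

/-- Auxiliary: the pairs `(y, g)` of `S`-points such that `y` is an `N`-isomorphism from `Q_S` to its
twist by `g` and acts on `V_S` as `g`. -/
noncomputable def intertwiners (hN : N.IsNormal) (ρ : N.toKGroup ⟶ GenLin k Q)
    (V : Submodule k Q) (σ : G ⟶ GenLin k V) (S : CommAlgCat.{u} k) :
    Subgroup ((GenLin k Q).obj S × G.obj S) where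
  carrier := {p | (∀ (T : CommAlgCat.{u} k) (f : S ⟶ T) (n : N.pts T),
      ((GenLin k Q).map f).hom p.1 * (ρ.app T).hom n =
        (ρ.app T).hom (conjPt hN ((G.map f).hom p.2) n) * ((GenLin k Q).map f).hom p.1) ∧
      ∀ v : S ⊗[k] V, act (val p.1) (incl V S v) = incl V S (act (val ((σ.app S).hom p.2)) v)}
  one_mem' := by
    refine ⟨fun T f n => ?_, fun v => ?_⟩
    · have : conjPt hN ((G.map f).hom (1 : (GenLin k Q).obj S × G.obj S).2) n = n := by
        apply Subtype.ext
        simp [conjPt]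
      rw [this]
      simp
    · have h1 : val (1 : (GenLin k Q).obj S × G.obj S).1 = 1 := rfl
      have h2 : val ((σ.app S).hom (1 : (GenLin k Q).obj S × G.obj S).2) = 1 := by
        rw [Prod.snd_one, map_one]; rfl
      rw [h1, h2, map_one, map_one]; rfl
  mul_mem' := by
    rintro ⟨y, g⟩ ⟨z, h⟩ ⟨hy, hy'⟩ ⟨hz, hz'⟩
    refine ⟨fun T f n => ?_, fun v => ?_⟩
    · have : conjPt hN ((G.map f).hom (g * h)) n =
          conjPt hN ((G.map f).hom g) (conjPt hN ((G.map f).hom h) n) := by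
        apply Subtype.ext
        simp [conjPt, mul_assoc]
      have e1 := hy T f (conjPt hN ((G.map f).hom h) n)
      have e2 := hz T f n
      dsimp only at e1 e2
      change ((GenLin k Q).map f).hom (y * z) * _ = (ρ.app T).hom (conjPt hN ((G.map f).hom (g * h)) n) *
        ((GenLin k Q).map f).hom (y * z)
      rw [this, map_mul, mul_assoc, e2, ← mul_assoc, e1, mul_assoc]
    · have h1 : val (y * z) = val y * val z := rfl
      have h2 : val ((σ.app S).hom (g * h)) = val ((σ.app S).hom g) * val ((σ.app S).hom h) := by
        rw [map_mul]; rfl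
      change act (val (y * z)) _ = incl V S (act (val ((σ.app S).hom (g * h))) v)
      rw [h1, h2, map_mul, map_mul, Module.End.mul_apply, Module.End.mul_apply, hz', hy']
  inv_mem' := by
    rintro ⟨y, g⟩ ⟨hy, hy'⟩
    refine ⟨fun T f n => ?_, fun v => ?_⟩
    · have e1 := hy T f (conjPt hN ((G.map f).hom g⁻¹) n)
      have : conjPt hN ((G.map f).hom g) (conjPt hN ((G.map f).hom g⁻¹) n) = n := by
        apply Subtype.ext
        simp [conjPt, mul_assoc]
      dsimp only at e1
      rw [this] at e1
      change ((GenLin k Q).map f).hom y⁻¹ * _ = (ρ.app T).hom (conjPt hN ((G.map f).hom g⁻¹) n) *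
        ((GenLin k Q).map f).hom y⁻¹
      rw [map_inv, eq_mul_inv_iff_mul_eq, mul_assoc, ← e1, inv_mul_cancel_left]
    · have h1 : val y⁻¹ * val y = 1 := Units.inv_mul (α := S ⊗[k] Module.End k Q) y
      have h2 : val ((σ.app S).hom g) * val ((σ.app S).hom g⁻¹) = 1 := by
        rw [map_inv]
        exact Units.mul_inv (α := S ⊗[k] Module.End k V) _
      have e := hy' (act (val ((σ.app S).hom g⁻¹)) v)
      dsimp only at e
      rw [← Module.End.mul_apply, ← map_mul, h2, map_one, Module.End.one_apply] at e
      change act (val y⁻¹) (incl V S v) = incl V S (act (val ((σ.app S).hom g⁻¹)) v)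
      rw [← e, ← Module.End.mul_apply, ← map_mul, h1, map_one, Module.End.one_apply]

lemma sub_one_mem_iff (hN : N.IsNormal) (ρ : N.toKGroup ⟶ GenLin k Q)
    (V : Submodule k Q) (σ : G ⟶ GenLin k V) {S : CommAlgCat.{u} k} (y : (GenLin k Q).obj S) :
    val y - 1 ∈ (annihilator ρ V).baseChange S ↔ (y, (1 : G.obj S)) ∈ intertwiners hN ρ V σ S := by
  have hc : ∀ (T : CommAlgCat.{u} k) (f : S ⟶ T) (n : N.pts T),
      conjPt hN ((G.map f).hom (1 : G.obj S)) n = n := by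
    intro T f n
    apply Subtype.ext
    simp [conjPt]
  have h1 : val ((σ.app S).hom (1 : G.obj S)) = 1 := by
    rw [map_one]; rfl
  rw [mem_annihilator_baseChange]
  constructor
  · rintro ⟨h, h'⟩
    refine ⟨fun T f n => ?_, fun v => ?_⟩
    · have e := h T f n
      rw [map_sub, map_one, sub_mul, mul_sub, one_mul, mul_one, sub_left_inj] at e
      change _ = (ρ.app T).hom (conjPt hN ((G.map f).hom (1 : G.obj S)) n) * _
      rw [hc]
      exact Units.ext e
    · have e := incl_eq_of V h' v
      rw [map_sub, map_one, LinearMap.sub_apply, sub_eq_zero] at e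
      change act (val y) (incl V S v) = incl V S (act (val ((σ.app S).hom (1 : G.obj S))) v)
      rw [e, h1, map_one]; rfl
  · rintro ⟨h, h'⟩
    refine ⟨fun T f n => ?_, fun v hv => ?_⟩
    · have e := h T f n
      dsimp only at e
      rw [hc] at e
      rw [map_sub, map_one, sub_mul, mul_sub, one_mul, mul_one, sub_left_inj]
      exact congrArg val e
    · have e := h' (1 ⊗ₜ[k] ⟨v, hv⟩)
      dsimp only at e
      rw [h1, map_one, Module.End.one_apply] at e
      rw [map_sub, map_one, LinearMap.sub_apply, sub_eq_zero]
      exact e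

lemma mul_mem_annihilator (ρ : N.toKGroup ⟶ GenLin k Q) (V : Submodule k Q)
    {S : CommAlgCat.{u} k} {x y : S ⊗[k] Module.End k Q}
    (hx : ∀ (T : CommAlgCat.{u} k) (f : S ⟶ T) (n : N.pts T),
        extend f x * op ρ n = op ρ n * extend f x)
    (hy : y ∈ (annihilator ρ V).baseChange S) :
    x * y ∈ (annihilator ρ V).baseChange S := by
  rw [mem_annihilator_baseChange] at hy ⊢
  refine ⟨fun T f n => ?_, fun v hv => ?_⟩
  · rw [map_mul, mul_assoc, hy.1, ← mul_assoc, hx, mul_assoc]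
  · rw [map_mul, Module.End.mul_apply, hy.2 v hv, map_zero]

lemma comm_of_sub_one_mem (ρ : N.toKGroup ⟶ GenLin k Q) (V : Submodule k Q)
    {S : CommAlgCat.{u} k} {x : S ⊗[k] Module.End k Q}
    (hx : x - 1 ∈ (annihilator ρ V).baseChange S) (T : CommAlgCat.{u} k) (f : S ⟶ T)
    (n : N.pts T) : extend f x * op ρ n = op ρ n * extend f x := by
  have c := ((mem_annihilator_baseChange ρ V _).1 hx).1 T f n
  rwa [map_sub, map_one, sub_mul, mul_sub, one_mul, mul_one, sub_left_inj] at c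

/-- The subgroup functor `U = 1 + J_V` of `GL_k(Q)`, with `U(S) = 1 + S ⊗ J_V`. -/
noncomputable def unipotent (ρ : N.toKGroup ⟶ GenLin k Q) (V : Submodule k Q) :
    SubgroupFunctor (GenLin k Q) where
  pts S :=
    { carrier := {y | val y - 1 ∈ (annihilator ρ V).baseChange S}
      one_mem' := by
        change val (1 : (GenLin k Q).obj S) - 1 ∈ (annihilator ρ V).baseChange S
        have : val (1 : (GenLin k Q).obj S) - 1 = 0 := sub_self _
        rw [this]
        exact zero_mem _
      mul_mem' := by
        intro y z hy hz
        change val (y * z) - 1 ∈ (annihilator ρ V).baseChange S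
        have e : val (y * z) - 1 = val y * (val z - 1) + (val y - 1) := by
          rw [mul_sub, mul_one, sub_add_sub_cancel]; rfl
        rw [e]
        exact add_mem (mul_mem_annihilator ρ V (comm_of_sub_one_mem ρ V hy) hz) hy
      inv_mem' := by
        intro y hy
        change val y⁻¹ - 1 ∈ (annihilator ρ V).baseChange S
        have h1 : val y⁻¹ * val y = 1 := Units.inv_mul (α := S ⊗[k] Module.End k Q) y
        have h2 : val y * val y⁻¹ = 1 := Units.mul_inv (α := S ⊗[k] Module.End k Q) y
        have e : val y⁻¹ - 1 = val y⁻¹ * (1 - val y) := by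
          rw [mul_sub, h1, mul_one]
        have hy' : 1 - val y ∈ (annihilator ρ V).baseChange S := by
          rw [← neg_sub]
          exact neg_mem hy
        rw [e]
        refine mul_mem_annihilator ρ V (fun T f n => ?_) hy'
        have c := comm_of_sub_one_mem ρ V hy T f n
        have h1' : extend f (val y⁻¹) * extend f (val y) = 1 := by rw [← map_mul, h1, map_one]
        have h2' : extend f (val y) * extend f (val y⁻¹) = 1 := by rw [← map_mul, h2, map_one]
        calc extend f (val y⁻¹) * op ρ n
            = extend f (val y⁻¹) * (op ρ n * extend f (val y)) * extend f (val y⁻¹) := by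
              rw [mul_assoc, mul_assoc, h2', mul_one]
          _ = op ρ n * extend f (val y⁻¹) := by
              rw [← c, ← mul_assoc, h1', one_mul] }
  map_mem {S T} f y hy := by
    have h := extend_mem_annihilator ρ V f hy
    rw [map_sub, map_one] at h
    exact h

namespace StructureMap

variable {hN : N.IsNormal} {ρ : N.toKGroup ⟶ GenLin k Q} {V : Submodule k Q}
  {σ : G ⟶ GenLin k V} (α : StructureMap hN ρ V σ)

lemma mem_intertwiners {S : CommAlgCat.{u} k} (g : G.obj S) :
    (α.toFun S g, g) ∈ intertwiners hN ρ V σ S :=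
  ⟨fun T f n => by
    change ((GenLin k Q).map f).hom (α.toFun S g) * (ρ.app T).hom n =
      (ρ.app T).hom (conjPt hN ((G.map f).hom g) n) * ((GenLin k Q).map f).hom (α.toFun S g)
    rw [← α.naturality f g]
    exact α.conj T _ n, fun v => α.restrict S g v⟩

/-- The conjugation action `κ(g, u) = α(g) u α(g)⁻¹` of `G` on `U`. -/
noncomputable def kappa {S : CommAlgCat.{u} k} (g : G.obj S) (u : (unipotent ρ V).pts S) :
    (unipotent ρ V).pts S :=
  ⟨α.toFun S g * u.1 * (α.toFun S g)⁻¹, by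
    have h := mul_mem (mul_mem (α.mem_intertwiners g) ((sub_one_mem_iff hN ρ V σ u.1).1 u.2))
      (inv_mem (α.mem_intertwiners g))
    refine (sub_one_mem_iff hN ρ V σ _).2 ?_
    have e : ((α.toFun S g, g) * (u.1, (1 : G.obj S)) * (α.toFun S g, g)⁻¹ :
        (GenLin k Q).obj S × G.obj S) = (α.toFun S g * u.1 * (α.toFun S g)⁻¹, 1) :=
      Prod.ext rfl (by simp)
    rwa [e] at h⟩

/-- The factor set `γ(g, h) = α(g) α(h) α(gh)⁻¹`. -/
noncomputable def gamma {S : CommAlgCat.{u} k} (g h : G.obj S) : (unipotent ρ V).pts S :=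
  ⟨α.toFun S g * α.toFun S h * (α.toFun S (g * h))⁻¹, by
    have h' := mul_mem (mul_mem (α.mem_intertwiners g) (α.mem_intertwiners h))
      (inv_mem (α.mem_intertwiners (g * h)))
    refine (sub_one_mem_iff hN ρ V σ _).2 ?_
    have e : ((α.toFun S g, g) * (α.toFun S h, h) * (α.toFun S (g * h), g * h)⁻¹ :
        (GenLin k Q).obj S × G.obj S) =
          (α.toFun S g * α.toFun S h * (α.toFun S (g * h))⁻¹, 1) :=
      Prod.ext rfl (by simp)
    rwa [e] at h'⟩

/-- The `S`-points of `G^⋄`: the set `U(S) × G(S)`. -/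
@[ext]
structure DiamondPts (α : StructureMap hN ρ V σ) (S : CommAlgCat.{u} k) where
  u : (unipotent ρ V).pts S
  g : G.obj S

namespace DiamondPts

variable {α} {S : CommAlgCat.{u} k}

/-- `(x, g)(y, h) = (x κ(g, y) γ(g, h), gh)`. -/
noncomputable instance : Mul (α.DiamondPts S) :=
  ⟨fun p q => ⟨p.u * α.kappa p.g q.u * α.gamma p.g q.g, p.g * q.g⟩⟩

noncomputable instance : One (α.DiamondPts S) := ⟨⟨1, 1⟩⟩

/-- `(x, g)⁻¹ = (γ(g⁻¹, g)⁻¹ κ(g⁻¹, x)⁻¹, g⁻¹)`. -/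
noncomputable instance : Inv (α.DiamondPts S) :=
  ⟨fun p => ⟨(α.gamma p.g⁻¹ p.g)⁻¹ * (α.kappa p.g⁻¹ p.u)⁻¹, p.g⁻¹⟩⟩

/-- The operator `u α(g)` attached to `(u, g)`. -/
noncomputable def toGenLin (p : α.DiamondPts S) : (GenLin k Q).obj S := p.u.1 * α.toFun S p.g

lemma toGenLin_mul (p q : α.DiamondPts S) : (p * q).toGenLin = p.toGenLin * q.toGenLin := by
  change (p.u.1 * (α.toFun S p.g * q.u.1 * (α.toFun S p.g)⁻¹) *
    (α.toFun S p.g * α.toFun S q.g * (α.toFun S (p.g * q.g))⁻¹)) * α.toFun S (p.g * q.g) =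
      (p.u.1 * α.toFun S p.g) * (q.u.1 * α.toFun S q.g)
  group

lemma toGenLin_one : (1 : α.DiamondPts S).toGenLin = 1 := by
  change (1 : (GenLin k Q).obj S) * α.toFun S 1 = 1
  rw [α.map_one, one_mul]

lemma eq_of {p q : α.DiamondPts S} (h : p.toGenLin = q.toGenLin) (h' : p.g = q.g) : p = q := by
  refine DiamondPts.ext (Subtype.ext ?_) h'
  change p.u.1 * α.toFun S p.g = q.u.1 * α.toFun S q.g at h
  rwa [h', mul_left_inj] at h

noncomputable instance : Group (α.DiamondPts S) :=
  Group.ofLeftAxioms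
    (fun p q r => eq_of (by simp only [toGenLin_mul, mul_assoc]) (mul_assoc p.g q.g r.g))
    (fun p => eq_of (by rw [toGenLin_mul, toGenLin_one, one_mul]) (one_mul p.g))
    (fun p => eq_of (by
      rw [toGenLin_mul, toGenLin_one]
      change (α.toFun S p.g⁻¹ * α.toFun S p.g * (α.toFun S (p.g⁻¹ * p.g))⁻¹)⁻¹ *
        (α.toFun S p.g⁻¹ * p.u.1 * (α.toFun S p.g⁻¹)⁻¹)⁻¹ * α.toFun S p.g⁻¹ *
          (p.u.1 * α.toFun S p.g) = 1
      rw [inv_mul_cancel, α.map_one]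
      group) (inv_mul_cancel p.g))

end DiamondPts

/-- The extension group `G^⋄ = G^⋄(Q, V, α)` as a `k`-group functor. -/
noncomputable def diamond : KGroup k where
  obj S := GrpCat.of (α.DiamondPts S)
  map {S T} f := GrpCat.ofHom
    { toFun := fun p => ⟨⟨((GenLin k Q).map f).hom p.u.1, (unipotent ρ V).map_mem f _ p.u.2⟩,
        (G.map f).hom p.g⟩
      map_one' := DiamondPts.ext
        (Subtype.ext (_root_.map_one ((GenLin k Q).map f).hom)) (_root_.map_one (G.map f).hom)
      map_mul' := fun p q => by
        refine DiamondPts.ext (Subtype.ext ?_) (map_mul (G.map f).hom p.g q.g)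
        change ((GenLin k Q).map f).hom (p.u.1 * (α.toFun S p.g * q.u.1 * (α.toFun S p.g)⁻¹) *
            (α.toFun S p.g * α.toFun S q.g * (α.toFun S (p.g * q.g))⁻¹)) =
          ((GenLin k Q).map f).hom p.u.1 * (α.toFun T ((G.map f).hom p.g) *
            ((GenLin k Q).map f).hom q.u.1 * (α.toFun T ((G.map f).hom p.g))⁻¹) *
            (α.toFun T ((G.map f).hom p.g) * α.toFun T ((G.map f).hom q.g) *
              (α.toFun T ((G.map f).hom p.g * (G.map f).hom q.g))⁻¹)
        simp only [← map_mul, ← map_inv, α.naturality] }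
  map_id S := by
    refine GrpCat.ext fun p => DiamondPts.ext (Subtype.ext ?_) ?_
    · change ((GenLin k Q).map (𝟙 S)).hom p.u.1 = p.u.1
      rw [CategoryTheory.Functor.map_id]; rfl
    · change (G.map (𝟙 S)).hom p.g = p.g
      rw [CategoryTheory.Functor.map_id]; rfl
  map_comp f f' := by
    refine GrpCat.ext fun p => DiamondPts.ext (Subtype.ext ?_) ?_
    · change ((GenLin k Q).map (f ≫ f')).hom p.u.1 =
        ((GenLin k Q).map f').hom (((GenLin k Q).map f).hom p.u.1)
      rw [CategoryTheory.Functor.map_comp]; rfl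
    · change (G.map (f ≫ f')).hom p.g = (G.map f').hom ((G.map f).hom p.g)
      rw [CategoryTheory.Functor.map_comp]; rfl

/-- The homomorphism `ρ^⋄ : G^⋄ → GL_k(Q)`, `(u, g) ↦ u α(g)`. -/
noncomputable def diamondRep : α.diamond ⟶ GenLin k Q where
  app S := GrpCat.ofHom
    { toFun := fun p : α.DiamondPts S => p.toGenLin
      map_one' := DiamondPts.toGenLin_one
      map_mul' := DiamondPts.toGenLin_mul }
  naturality S T f := by
    refine GrpCat.ext fun (p : α.DiamondPts S) => ?_
    change ((GenLin k Q).map f).hom p.u.1 * α.toFun T ((G.map f).hom p.g) =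
      ((GenLin k Q).map f).hom (p.u.1 * α.toFun S p.g)
    rw [α.naturality, map_mul]

/-- The projection `G^⋄ → G`, `(u, g) ↦ g`. -/
noncomputable def diamondProj : α.diamond ⟶ G where
  app S := GrpCat.ofHom
    { toFun := fun p : α.DiamondPts S => p.g
      map_one' := rfl
      map_mul' := fun _ _ => rfl }
  naturality _ _ _ := rfl

end StructureMap

end Stability

end KGroup

/-!
A pair `(y, g)` of points of `GL(Q)` and `G` is an *intertwiner* (`KGroup.intertwiners`) if `y` is
an `N`-isomorphism from `Q` to its twist by `g` which acts on `V` as `g` does. Intertwiners form a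
group, those with `g = 1` are the elements of `U`, and a structure map `α` is a section
`g ↦ (α(g), g)`. Hence the points of `G^⋄` are exactly the intertwiners
(`StructureMap.diamondPt`, `StructureMap.diamondLift`), whatever `α` is. This gives the isomorphisms
between the groups `G^⋄` and the independence of `G^*` from `α`. Two intertwiners over the same `g`
differ by an element of `U`, so that `g ↦ α(g) U` is a homomorphism independent of `α`; and a point
of `G^*` with the same class modulo `U` as `α(g)` intertwines over `g`, which is the pullback
property (`StructureMap.isPullback`).

The remaining assertions say that the groups involved are algebraic.

* `G^⋄` is `U × G` as a scheme. An endomorphism in `J_V` kills the socle, hence is nilpotent; so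
  `J_V` is a nil left ideal of a finite dimensional algebra, it is nilpotent, and `U = 1 + J_V` is
  an affine space (`exists_isUniversal_unipotent`, `isNilpotent_of_mem_annihilator_baseChange`).
* The image of a homomorphism `h : F' ⟶ F` is the zero locus of the regular functions on `F` that
  vanish on the points coming from `F'` (`image_eq_zeroLocus`). That this locus is a subgroup is
  checked by slicing functions of two variables with linear functionals on the coefficients. Its
  coordinate algebra is the image of the comorphism of `h` (`exists_isUniversal_image`).
* Over an algebraically closed field `F'(k)` maps onto the `k`-points of the image
  (`exists_toImage_eq`), by Chevalley's theorem and the usual density argument.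
* The quotient `G^*/U` is obtained from a representation (`exists_isQuotient_image`): `U` is the
  subgroup of `GL(Q)` which fixes `V` pointwise and commutes with the span `R` of the operators by
  which `N` acts, while `G^*` stabilizes `V` and normalizes `R`. So `U` is the kernel of
  `G^* → GL(V) × GL(R)`, and the image of this homomorphism is the quotient.
-/

/-! ### Points of finitely generated algebras over an algebraically closed field -/

section Points

variable {k D : Type*} [Field k] [IsAlgClosed k] [CommRing D] [Algebra k D]
  [Algebra.FiniteType k D]

/-- Hilbert's Nullstellensatz: maximal ideals are the kernels of rational points. -/
lemma Ideal.exists_algHom_ker_eq (m : Ideal D) [m.IsMaximal] :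
    ∃ χ : D →ₐ[k] k, RingHom.ker χ = m := by
  let : Field (D ⧸ m) := Ideal.Quotient.field m
  have := finite_of_finite_type_of_isJacobsonRing k (D ⧸ m)
  let ψ : (D ⧸ m) →ₐ[k] k := IsAlgClosed.lift
  refine ⟨ψ.comp (Ideal.Quotient.mkₐ k m), Ideal.ext fun d => ?_⟩
  rw [RingHom.mem_ker, AlgHom.comp_apply, map_eq_zero_iff ψ ψ.toRingHom.injective]
  exact Ideal.Quotient.eq_zero_iff_mem

variable (k) in
lemma exists_algHom_apply_ne_zero [IsReduced D] {d : D} (hd : d ≠ 0) :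
    ∃ χ : D →ₐ[k] k, χ d ≠ 0 := by
  have : IsJacobsonRing D := isJacobsonRing_of_finiteType (A := k)
  have h : (⊥ : Ideal D).jacobson = ⊥ :=
    IsJacobsonRing.out this Ideal.isRadical_bot
  have hd' : d ∉ (⊥ : Ideal D).jacobson := by rw [h]; exact hd
  rw [Ideal.jacobson, Ideal.mem_sInf] at hd'
  push Not at hd'
  obtain ⟨m, ⟨-, hm⟩, hdm⟩ := hd'
  obtain ⟨χ, rfl⟩ := m.exists_algHom_ker_eq (k := k)
  exact ⟨χ, hdm⟩

omit [IsAlgClosed k] [Algebra.FiniteType k D] in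
lemma AlgHom.ext_of_ker_le {χ χ' : D →ₐ[k] k} (h : RingHom.ker χ ≤ RingHom.ker χ') : χ = χ' := by
  refine AlgHom.ext fun d => ?_
  have : d - algebraMap k D (χ d) ∈ RingHom.ker χ' := h (by simp [RingHom.mem_ker])
  rw [RingHom.mem_ker, map_sub, AlgHom.commutes, sub_eq_zero] at this
  exact this.symm

end Points

/-- The local ring at a minimal prime of a reduced ring is a field, so the elements of the prime
vanish in it. -/
lemma Ideal.exists_notMem_mul_eq_zero {R : Type*} [CommRing R] [IsReduced R] {p : Ideal R}
    (hp : p ∈ minimalPrimes R) {x : R} (hx : x ∈ p) : ∃ t ∉ p, t * x = 0 := by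
  have := hp.isPrime
  have h := IsLocalization.AtPrime.radical_map_of_mem_minimalPrimes (Localization.AtPrime p) p ⊥ hp
  rw [Ideal.map_bot] at h
  have hx' := Ideal.mem_map_of_mem (algebraMap R (Localization.AtPrime p)) hx
  rw [← h] at hx'
  obtain ⟨n, hn⟩ := hx'
  rw [Ideal.mem_bot, ← map_pow, IsLocalization.map_eq_zero_iff p.primeCompl] at hn
  obtain ⟨t, ht⟩ := hn
  refine ⟨t, t.2, pow_eq_zero_iff (n := n + 1) n.succ_ne_zero |>.1 ?_⟩
  rw [show ((t : R) * x) ^ (n + 1) = t ^ n * x * (t * x ^ n) by ring, ht, mul_zero]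

/-- A dominant morphism of affine varieties is surjective on points over some nonempty basic
open set, by Chevalley's theorem. -/
lemma exists_ne_zero_forall_exists_algHom_comp_eq {k C D : Type*} [Field k] [IsAlgClosed k]
    [CommRing C] [CommRing D] [Algebra k C] [Algebra k D] [Algebra.FiniteType k C]
    [Algebra.FiniteType k D] [IsReduced C] [Nontrivial C]
    (ψ : C →ₐ[k] D) (hψ : Function.Injective ψ) :
    ∃ c : C, c ≠ 0 ∧ ∀ χ : C →ₐ[k] k, χ c ≠ 0 → ∃ χ' : D →ₐ[k] k, χ'.comp ψ = χ := by
  classical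
  have : IsNoetherianRing C := Algebra.FiniteType.isNoetherianRing k C
  have hft : ψ.toRingHom.FiniteType :=
    RingHom.FiniteType.of_comp_finiteType (f := algebraMap k C) (by
      rw [AlgHom.toRingHom_eq_coe, AlgHom.comp_algebraMap]
      exact (RingHom.finiteType_algebraMap (A := k) (B := D)).2 inferInstance)
  have hfp : ψ.toRingHom.FinitePresentation := RingHom.FinitePresentation.of_finiteType.1 hft
  obtain ⟨S, hS⟩ := PrimeSpectrum.exists_constructibleSetData_iff.2
    (PrimeSpectrum.isConstructible_range_comap hfp)
  obtain ⟨m, hm⟩ := Ideal.exists_maximal C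
  obtain ⟨p, hp, -⟩ := Ideal.exists_minimalPrimes_le (bot_le : ⊥ ≤ m)
  have hpp : p.IsPrime := hp.isPrime
  obtain ⟨p', hp', hpe⟩ := Ideal.exists_comap_eq_of_mem_minimalPrimes_of_injective
    (f := ψ.toRingHom) hψ p hp
  have hmem : (⟨p, hpp⟩ : PrimeSpectrum C) ∈ S.toSet := by
    rw [hS]
    exact ⟨⟨p', hp'⟩, PrimeSpectrum.ext hpe⟩
  rw [PrimeSpectrum.ConstructibleSetData.toSet, Set.mem_iUnion₂] at hmem
  obtain ⟨B, hB, hBp⟩ := hmem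
  have hg : ∀ i, B.g i ∈ p := fun i => hBp.1 ⟨i, rfl⟩
  have hf : B.f ∉ p := fun h => hBp.2 (by
    rintro _ rfl
    exact h)
  -- annihilators, off `p`, of the equations `B.g i`
  choose t ht ht' using fun i => Ideal.exists_notMem_mul_eq_zero hp (hg i)
  refine ⟨B.f * ∏ i, t i, fun h0 => ?_, fun χ hχ => ?_⟩
  · have : B.f * ∏ i, t i ∈ p := h0 ▸ p.zero_mem
    rcases hpp.mem_or_mem this with h | h
    · exact hf h
    · obtain ⟨i, -, hi⟩ := (hpp.prod_mem_iff).1 h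
      exact ht i hi
  · rw [map_mul, map_prod, mul_ne_zero_iff, Finset.prod_ne_zero_iff] at hχ
    have hq : (⟨RingHom.ker χ, RingHom.ker_isPrime χ⟩ : PrimeSpectrum C) ∈ S.toSet := by
      rw [PrimeSpectrum.ConstructibleSetData.toSet, Set.mem_iUnion₂]
      refine ⟨B, hB, ?_, fun h => hχ.1 (h rfl)⟩
      rintro _ ⟨i, rfl⟩
      have := congrArg χ (ht' i)
      rw [map_mul, map_zero] at this
      exact (mul_eq_zero.1 this).resolve_left (hχ.2 i (Finset.mem_univ i))
    rw [hS] at hq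
    obtain ⟨q, hq⟩ := hq
    obtain ⟨m, hm, hqm⟩ := Ideal.exists_le_maximal q.asIdeal q.2.ne_top
    obtain ⟨χ', rfl⟩ := m.exists_algHom_ker_eq (k := k)
    refine ⟨χ', (AlgHom.ext_of_ker_le fun c hc => ?_).symm⟩
    have hc' : c ∈ (PrimeSpectrum.comap ψ.toRingHom q).asIdeal := by rw [hq]; exact hc
    exact hqm hc'

namespace KGroup

variable {k : Type u} [Field k]

/-! ### Universal points of group functors -/

section Universal

variable {F F' : KGroup k} {R S T : CommAlgCat.{u} k}

lemma map_id_apply (x : F.obj S) : (F.map (𝟙 S)).hom x = x := by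
  rw [F.map_id]; rfl

lemma map_comp_apply (f : R ⟶ S) (g : S ⟶ T) (x : F.obj R) :
    (F.map (f ≫ g)).hom x = (F.map g).hom ((F.map f).hom x) := by
  rw [F.map_comp]; rfl

lemma app_map_apply (h : F' ⟶ F) (f : S ⟶ T) (x : F'.obj S) :
    (h.app T).hom ((F'.map f).hom x) = (F.map f).hom ((h.app S).hom x) :=
  ConcreteCategory.congr_hom (h.naturality f) x

/-- A point `x ∈ F(A)` is universal if every point of `F` is the image of `x` under a unique
morphism out of `A`; by Yoneda this says that `A` is the coordinate algebra of `F`. -/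
def IsUniversal {A : CommAlgCat.{u} k} (x : F.obj A) : Prop :=
  ∀ (S : CommAlgCat.{u} k) (y : F.obj S), ∃! φ : A ⟶ S, (F.map φ).hom x = y

namespace IsUniversal

variable {A : CommAlgCat.{u} k} {x : F.obj A}

lemma hom_ext (hx : IsUniversal x) {φ ψ : A ⟶ S} (h : (F.map φ).hom x = (F.map ψ).hom x) :
    φ = ψ :=
  (hx S _).unique h rfl

/-- The morphism `A ⟶ S` classifying a point `y ∈ F(S)`. -/
noncomputable def desc (hx : IsUniversal x) (y : F.obj S) : A ⟶ S := (hx S y).exists.choose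

lemma map_desc (hx : IsUniversal x) (y : F.obj S) : (F.map (hx.desc y)).hom x = y :=
  (hx S y).exists.choose_spec

lemma desc_map (hx : IsUniversal x) (f : S ⟶ T) (y : F.obj S) :
    hx.desc ((F.map f).hom y) = hx.desc y ≫ f :=
  hx.hom_ext (by rw [map_desc, map_comp_apply, map_desc])

/-- The regular function on `F` given by an element of the coordinate algebra. -/
noncomputable def regular (hx : IsUniversal x) (a : A) : RegularFunction F where
  toFun _ y := (hx.desc y).hom a
  naturality f y := by rw [desc_map]; rfl

lemma nonempty_corepresentableBy (hx : IsUniversal x) :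
    Nonempty ((F ⋙ forget GrpCat.{u}).CorepresentableBy A) :=
  ⟨{ homEquiv := fun {S} =>
      { toFun := fun φ => (F.map φ).hom x
        invFun := fun y => hx.desc (S := S) y
        left_inv := fun _ => hx.hom_ext (hx.map_desc _)
        right_inv := fun y => hx.map_desc (S := S) y }
     homEquiv_comp := fun g f => map_comp_apply f g x }⟩

lemma isAffineAlgebraic (hx : IsUniversal x) [Algebra.FiniteType k A] [IsReduced A] :
    F.IsAffineAlgebraic :=
  ⟨A, inferInstance, inferInstance, hx.nonempty_corepresentableBy⟩

end IsUniversal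

lemma IsAffineAlgebraic.exists_isUniversal (hF : F.IsAffineAlgebraic) :
    ∃ (A : CommAlgCat.{u} k) (x : F.obj A), Algebra.FiniteType k A ∧ IsReduced A ∧
      IsUniversal x := by
  obtain ⟨A, h1, h2, ⟨e⟩⟩ := hF
  refine ⟨A, e.homEquiv (𝟙 A), h1, h2, fun S y => ⟨e.homEquiv.symm y, ?_, fun φ hφ => ?_⟩⟩
  · exact (e.homEquiv_eq (e.homEquiv.symm y)).symm.trans (e.homEquiv.apply_symm_apply y)
  · rw [Equiv.eq_symm_apply]
    exact (e.homEquiv_eq φ).trans hφ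

/-- If the points of `F` are pairs of points of `F₁` and `F₂`, as sets, then the coordinate algebra
of `F` is the tensor product of those of `F₁` and `F₂`. -/
lemma exists_isUniversal_tensorProduct {F₁ F₂ : KGroup k}
    (p₁ : ∀ S, F.obj S → F₁.obj S) (p₂ : ∀ S, F.obj S → F₂.obj S)
    (h₁ : ∀ {S T} (f : S ⟶ T) (x : F.obj S), p₁ T ((F.map f).hom x) = (F₁.map f).hom (p₁ S x))
    (h₂ : ∀ {S T} (f : S ⟶ T) (x : F.obj S), p₂ T ((F.map f).hom x) = (F₂.map f).hom (p₂ S x))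
    (hp : ∀ S, Function.Bijective fun x : F.obj S => (p₁ S x, p₂ S x))
    {A₁ A₂ : CommAlgCat.{u} k} {x₁ : F₁.obj A₁} {x₂ : F₂.obj A₂}
    (hx₁ : IsUniversal x₁) (hx₂ : IsUniversal x₂) :
    ∃ x : F.obj (CommAlgCat.of k (A₁ ⊗[k] A₂)), IsUniversal x := by
  let i₁ : A₁ ⟶ CommAlgCat.of k (A₁ ⊗[k] A₂) := CommAlgCat.ofHom Algebra.TensorProduct.includeLeft
  let i₂ : A₂ ⟶ CommAlgCat.of k (A₁ ⊗[k] A₂) := CommAlgCat.ofHom Algebra.TensorProduct.includeRight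
  obtain ⟨x, hx⟩ := (hp (CommAlgCat.of k (A₁ ⊗[k] A₂))).2
    ((F₁.map i₁).hom x₁, (F₂.map i₂).hom x₂)
  have e₁ := congrArg Prod.fst hx
  have e₂ := congrArg Prod.snd hx
  dsimp only at e₁ e₂
  refine ⟨x, fun S y => ?_⟩
  let φ : CommAlgCat.of k (A₁ ⊗[k] A₂) ⟶ S := CommAlgCat.ofHom
    (Algebra.TensorProduct.lift (hx₁.desc (p₁ S y)).hom (hx₂.desc (p₂ S y)).hom
      fun _ _ => Commute.all _ _)
  have hφ₁ : i₁ ≫ φ = hx₁.desc (p₁ S y) := by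
    ext a; simp [i₁, φ]
  have hφ₂ : i₂ ≫ φ = hx₂.desc (p₂ S y) := by
    ext a; simp [i₂, φ]
  refine ⟨φ, (hp S).1 (Prod.ext ?_ ?_), fun ψ hψ => ?_⟩
  · dsimp only
    rw [h₁, e₁, ← map_comp_apply, hφ₁, hx₁.map_desc]
  · dsimp only
    rw [h₂, e₂, ← map_comp_apply, hφ₂, hx₂.map_desc]
  · have g₁ : i₁ ≫ ψ = i₁ ≫ φ := by
      rw [hφ₁]
      refine hx₁.hom_ext ?_
      rw [hx₁.map_desc, map_comp_apply, ← e₁, ← h₁, hψ]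
    have g₂ : i₂ ≫ ψ = i₂ ≫ φ := by
      rw [hφ₂]
      refine hx₂.hom_ext ?_
      rw [hx₂.map_desc, map_comp_apply, ← e₂, ← h₂, hψ]
    refine CommAlgCat.hom_ext (Algebra.TensorProduct.ext ?_ ?_)
    · exact congrArg CommAlgCat.Hom.hom g₁
    · exact congrArg CommAlgCat.Hom.hom g₂

end Universal

/-! ### The image of a homomorphism -/

section Image

variable {F F' : KGroup k}

/-- The slices of a tensor along all functionals on the first factor determine it. -/
lemma eq_zero_of_slice_eq_zero {R S : Type u} [AddCommGroup R] [Module k R] [AddCommGroup S]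
    [Module k S] {e : R ⊗[k] S} (he : ∀ c : R →ₗ[k] k, slice c S e = 0) : e = 0 := by
  classical
  let b := Module.Basis.ofVectorSpace k R
  obtain ⟨a, rfl⟩ := (TensorProduct.equivFinsuppOfBasisLeft (N := S) b).symm.surjective e
  have : a = 0 := by
    ext i
    have h := he (b.coord i)
    rw [TensorProduct.equivFinsuppOfBasisLeft_symm_apply, Finsupp.sum, map_sum] at h
    simp only [slice_tmul, Module.Basis.coord_apply, Module.Basis.repr_self] at h
    rw [Finset.sum_eq_single i] at h
    · simpa using h
    · intro j _ hj; simp [Finsupp.single_eq_of_ne hj.symm]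
    · intro hi; simpa using hi
  rw [this, map_zero]

lemma slice_map {R S T : Type u} [CommRing R] [Algebra k R] [CommRing S] [Algebra k S]
    [CommRing T] [Algebra k T] (c : R →ₗ[k] k) (f : S →ₐ[k] T) (e : R ⊗[k] S) :
    slice c T (Algebra.TensorProduct.map (AlgHom.id k R) f e) = f (slice c S e) := by
  induction e with
  | zero => simp
  | add x y hx hy => rw [map_add, map_add, hx, hy, map_add, map_add]
  | tmul r s => simp

/-- A regular function vanishes on the image of `h`. -/
def VanishesOn (h : F' ⟶ F) (r : RegularFunction F) : Prop :=
  ∀ (T : CommAlgCat.{u} k) (x : F'.obj T), r.toFun T ((h.app T).hom x) = 0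

/-- If all regular functions vanishing on the image of `h` vanish at `y`, then so do all regular
functions defined over some base extension `R` which vanish on the image. This is the flatness of
`R` over `k`: such a function is recovered from its slices along the functionals on `R`. -/
lemma relative_eq_zero (h : F' ⟶ F) {R : CommAlgCat.{u} k}
    (Φ : ∀ S : CommAlgCat.{u} k, (R ⟶ S) → F.obj S → S)
    (hΦ : ∀ {S T : CommAlgCat.{u} k} (a : R ⟶ S) (f : S ⟶ T) (w : F.obj S),
      Φ T (a ≫ f) ((F.map f).hom w) = f.hom (Φ S a w))
    (h0 : ∀ (S : CommAlgCat.{u} k) (a : R ⟶ S) (x : F'.obj S), Φ S a ((h.app S).hom x) = 0)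
    {S : CommAlgCat.{u} k} (a : R ⟶ S) {y : F.obj S}
    (hy : ∀ r : RegularFunction F, VanishesOn h r → r.toFun S y = 0) : Φ S a y = 0 := by
  let i₁ (S : CommAlgCat.{u} k) : R ⟶ CommAlgCat.of k (R ⊗[k] S) :=
    CommAlgCat.ofHom Algebra.TensorProduct.includeLeft
  let i₂ (S : CommAlgCat.{u} k) : S ⟶ CommAlgCat.of k (R ⊗[k] S) :=
    CommAlgCat.ofHom Algebra.TensorProduct.includeRight
  let r (c : R →ₗ[k] k) : RegularFunction F :=
    { toFun := fun S w => slice c S (Φ _ (i₁ S) ((F.map (i₂ S)).hom w))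
      naturality := by
        intro S T f w
        let g : CommAlgCat.of k (R ⊗[k] S) ⟶ CommAlgCat.of k (R ⊗[k] T) :=
          CommAlgCat.ofHom (Algebra.TensorProduct.map (AlgHom.id k R) f.hom)
        have e₁ : i₁ T = i₁ S ≫ g := by
          ext a; simp [i₁, g]
        have e₂ : f ≫ i₂ T = i₂ S ≫ g := by
          ext a; simp [i₂, g]
        rw [← map_comp_apply, e₁, e₂, map_comp_apply, hΦ]
        exact slice_map c f.hom _ }
  have hr : ∀ c, VanishesOn h (r c) := by
    intro c T x
    change slice c T (Φ _ (i₁ T) ((F.map (i₂ T)).hom _)) = 0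
    rw [← app_map_apply, h0, map_zero]
  have key : Φ _ (i₁ S) ((F.map (i₂ S)).hom y) = 0 :=
    eq_zero_of_slice_eq_zero fun c => hy (r c) (hr c)
  let g : CommAlgCat.of k (R ⊗[k] S) ⟶ S := CommAlgCat.ofHom
    (Algebra.TensorProduct.lift a.hom (AlgHom.id k S) fun _ _ => Commute.all _ _)
  have e₁ : i₁ S ≫ g = a := by
    ext a; simp [i₁, g]
  have e₂ : i₂ S ≫ g = 𝟙 S := by
    ext a; simp [i₂, g]
  have := hΦ (i₁ S) g ((F.map (i₂ S)).hom y)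
  rwa [e₁, ← map_comp_apply, e₂, map_id_apply, key, map_zero] at this

/-- The common zero locus of the regular functions vanishing on the image of `h`. It is a subgroup
because multiplication can be tested on points of the image, one factor at a time. -/
def zeroLocus (h : F' ⟶ F) : SubgroupFunctor F where
  pts S :=
    { carrier := {y | ∀ r : RegularFunction F, VanishesOn h r → r.toFun S y = 0}
      one_mem' := fun r hr => by
        have := hr S 1
        rwa [map_one] at this
      mul_mem' := by
        have step : ∀ {R : CommAlgCat.{u} k} (x : F'.obj R) {z : F.obj R},
            (∀ r : RegularFunction F, VanishesOn h r → r.toFun R z = 0) →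
            ∀ r : RegularFunction F, VanishesOn h r → r.toFun R ((h.app R).hom x * z) = 0 := by
          intro R x z hz r hr
          have := relative_eq_zero h (R := R)
            (fun S a w => r.toFun S ((h.app S).hom ((F'.map a).hom x) * w))
            (fun a f w => by rw [map_comp_apply, app_map_apply, ← map_mul, r.naturality])
            (fun S a x' => by rw [← map_mul]; exact hr S _) (𝟙 R) hz
          rwa [map_id_apply] at this
        intro y z hy hz r hr
        have := relative_eq_zero h (R := S)
          (fun T a w => r.toFun T (w * (F.map a).hom z))
          (fun a f w => by rw [map_comp_apply, ← map_mul, r.naturality])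
          (fun T a x' => step x' (fun r' hr' => by rw [r'.naturality, hz r' hr', map_zero]) r hr)
          (𝟙 S) hy
        rwa [map_id_apply] at this
      inv_mem' := fun {y} hy r hr => by
        let r' : RegularFunction F :=
          { toFun := fun S w => r.toFun S w⁻¹
            naturality := fun f w => by rw [← map_inv, r.naturality] }
        refine hy r' fun T x => ?_
        change r.toFun T ((h.app T).hom x)⁻¹ = 0
        rw [← map_inv]
        exact hr T _ }
  map_mem f y hy r hr := by
    rw [r.naturality, hy r hr, map_zero]

lemma zeroLocus_isClosed (h : F' ⟶ F) : (zeroLocus h).IsClosed :=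
  ⟨{r | VanishesOn h r}, fun _ _ => Iff.rfl⟩

lemma app_mem_zeroLocus (h : F' ⟶ F) {S : CommAlgCat.{u} k} (x : F'.obj S) :
    (h.app S).hom x ∈ (zeroLocus h).pts S :=
  fun _ hr => hr S x

lemma image_eq_zeroLocus (h : F' ⟶ F) : SubgroupFunctor.image h = zeroLocus h := by
  refine SubgroupFunctor.ext (funext fun S => le_antisymm ?_ ?_)
  · exact iInf_le_of_le ⟨zeroLocus h, zeroLocus_isClosed h, fun T x => app_mem_zeroLocus h x⟩ le_rfl
  · refine le_iInf fun ⟨Z, ⟨I, hI⟩, hZ⟩ y hy => (hI S y).2 fun r hr => hy r fun T x => ?_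
    exact (hI T _).1 (hZ T x) r hr

lemma mem_image_iff (h : F' ⟶ F) {S : CommAlgCat.{u} k} {y : F.obj S} :
    y ∈ (SubgroupFunctor.image h).pts S ↔
      ∀ r : RegularFunction F, VanishesOn h r → r.toFun S y = 0 := by
  rw [image_eq_zeroLocus]; rfl

lemma app_mem_image (h : F' ⟶ F) {S : CommAlgCat.{u} k} (x : F'.obj S) :
    (h.app S).hom x ∈ (SubgroupFunctor.image h).pts S := by
  rw [image_eq_zeroLocus]; exact app_mem_zeroLocus h x

lemma image_isClosed (h : F' ⟶ F) : (SubgroupFunctor.image h).IsClosed := by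
  rw [image_eq_zeroLocus]; exact zeroLocus_isClosed h

/-- The corestriction of a homomorphism `h : F' ⟶ F` to a subgroup functor containing its image. -/
def SubgroupFunctor.lift (Z : SubgroupFunctor F) (h : F' ⟶ F)
    (hZ : ∀ (S : CommAlgCat.{u} k) (x : F'.obj S), (h.app S).hom x ∈ Z.pts S) :
    F' ⟶ Z.toKGroup where
  app S := GrpCat.ofHom ((h.app S).hom.codRestrict (Z.pts S) (hZ S))
  naturality _ _ f := GrpCat.ext fun x => Subtype.ext (app_map_apply h f x)

/-- The corestriction of a homomorphism to its image. -/
def toImage (h : F' ⟶ F) : F' ⟶ (SubgroupFunctor.image h).toKGroup :=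
  SubgroupFunctor.lift _ h fun _ x => app_mem_image h x

/-- The coordinate algebra of the image of `h` is the image of the comorphism of `h`: it is of
finite type, reduced, and embeds into the coordinate algebra of the source. -/
lemma exists_isUniversal_image (h : F' ⟶ F) {B D : CommAlgCat.{u} k} {x : F.obj B} {x' : F'.obj D}
    (hx : IsUniversal x) (hx' : IsUniversal x') [Algebra.FiniteType k B] [IsReduced D] :
    ∃ (C : CommAlgCat.{u} k) (z : (SubgroupFunctor.image h).toKGroup.obj C) (ψ : C ⟶ D),
      Algebra.FiniteType k C ∧ IsReduced C ∧ IsUniversal z ∧ Function.Injective ψ.hom ∧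
      ((SubgroupFunctor.image h).toKGroup.map ψ).hom z = ((toImage h).app D).hom x' := by
  let φ : B ⟶ D := hx.desc ((h.app D).hom x')
  let I : Ideal B := RingHom.ker φ.hom
  let C : CommAlgCat.{u} k := CommAlgCat.of k (B ⧸ I)
  let π : B ⟶ C := CommAlgCat.ofHom (Ideal.Quotient.mkₐ k I)
  have hπ : Function.Surjective π.hom := Ideal.Quotient.mkₐ_surjective k I
  let ψ : C ⟶ D := CommAlgCat.ofHom (Ideal.kerLiftAlg φ.hom)
  have hψ : Function.Injective ψ.hom := Ideal.kerLiftAlg_injective φ.hom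
  have hπψ : π ≫ ψ = φ := by
    ext b; rfl
  have hz : (F.map ψ).hom ((F.map π).hom x) = (h.app D).hom x' := by
    rw [← map_comp_apply, hπψ, hx.map_desc]
  let z : (SubgroupFunctor.image h).toKGroup.obj C := ⟨(F.map π).hom x, by
    rw [mem_image_iff]
    intro r hr
    refine hψ ?_
    rw [map_zero, ← hr D x', ← hz]
    exact (r.naturality ψ _).symm⟩
  refine ⟨C, z, ψ, ?_, ?_, ?_, hψ, Subtype.ext hz⟩
  · exact Algebra.FiniteType.of_surjective π.hom hπ
  · exact isReduced_of_injective ψ.hom hψ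
  · intro S y
    have hv : ∀ b ∈ I, (hx.desc y.1).hom b = 0 := by
      intro b hb
      refine (mem_image_iff h).1 y.2 (hx.regular b) fun T w => ?_
      change (hx.desc ((h.app T).hom w)).hom b = 0
      rw [← hx'.map_desc w, app_map_apply, hx.desc_map]
      change (hx'.desc w).hom (φ.hom b) = 0
      rw [show φ.hom b = 0 from hb, map_zero]
    have hfac : π ≫ CommAlgCat.ofHom (Ideal.Quotient.liftₐ I (hx.desc y.1).hom hv) =
        hx.desc y.1 := by
      ext b; rfl
    refine ⟨CommAlgCat.ofHom (Ideal.Quotient.liftₐ I (hx.desc y.1).hom hv), Subtype.ext ?_,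
      fun χ hχ => ?_⟩
    · change (F.map _).hom ((F.map π).hom x) = y.1
      rw [← map_comp_apply, hfac, hx.map_desc]
    · have e : π ≫ χ = hx.desc y.1 := by
        refine hx.hom_ext ?_
        rw [hx.map_desc, map_comp_apply]
        exact congrArg Subtype.val hχ
      rw [← hfac] at e
      refine CommAlgCat.hom_ext (AlgHom.ext fun c => ?_)
      obtain ⟨b, rfl⟩ := hπ c
      exact ConcreteCategory.congr_hom e b

lemma image_isAffineAlgebraic (h : F' ⟶ F) {B : CommAlgCat.{u} k} {x : F.obj B}
    (hx : IsUniversal x) [Algebra.FiniteType k B] (hF' : F'.IsAffineAlgebraic) :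
    (SubgroupFunctor.image h).toKGroup.IsAffineAlgebraic := by
  obtain ⟨D, x', -, _, hx'⟩ := hF'.exists_isUniversal
  obtain ⟨C, z, ψ, _, _, hz, -⟩ := exists_isUniversal_image h hx hx'
  exact hz.isAffineAlgebraic

/-- The comorphism of the corestriction of a homomorphism to its image is injective. -/
lemma toImage_comorphism_injective (h : F' ⟶ F) {B : CommAlgCat.{u} k} {x : F.obj B}
    (hx : IsUniversal x) [Algebra.FiniteType k B] (hF' : F'.IsAffineAlgebraic)
    {r r' : RegularFunction (SubgroupFunctor.image h).toKGroup}
    (hr : ∀ (S : CommAlgCat.{u} k) (w : F'.obj S),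
      r.toFun S (((toImage h).app S).hom w) = r'.toFun S (((toImage h).app S).hom w)) :
    r = r' := by
  obtain ⟨D, x', -, _, hx'⟩ := hF'.exists_isUniversal
  obtain ⟨C, z, ψ, -, -, hz, hψ, hzx⟩ := exists_isUniversal_image h hx hx'
  have e : r.toFun C z = r'.toFun C z := hψ (by
    rw [← r.naturality, ← r'.naturality, hzx, hr])
  ext S y
  rw [← hz.map_desc y, r.naturality, r'.naturality, e]

/-- The image of a homomorphism of affine algebraic groups is closed at the level of rational
points over an algebraically closed field: the image contains the points of a nonempty open subset
`D(c)` by Chevalley's theorem, and it is dense, so it meets every translate of `D(c)`. -/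
lemma exists_toImage_eq [IsAlgClosed k] (h : F' ⟶ F) {B : CommAlgCat.{u} k} {x : F.obj B}
    (hx : IsUniversal x) [Algebra.FiniteType k B] (hF' : F'.IsAffineAlgebraic)
    {y : F.obj (CommAlgCat.of k k)}
    (hy : y ∈ (SubgroupFunctor.image h).pts (CommAlgCat.of k k)) :
    ∃ w : F'.obj (CommAlgCat.of k k), (h.app (CommAlgCat.of k k)).hom w = y := by
  obtain ⟨D, x', _, _, hx'⟩ := hF'.exists_isUniversal
  obtain ⟨C, z, ψ, _, _, hz, hψ, hzx⟩ := exists_isUniversal_image h hx hx'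
  let K : CommAlgCat.{u} k := CommAlgCat.of k k
  let Z := SubgroupFunctor.image h
  let y' : Z.toKGroup.obj K := ⟨y, hy⟩
  have : Nontrivial C := (hz.desc y').hom.toRingHom.domain_nontrivial
  obtain ⟨c, hc, hlift⟩ := exists_ne_zero_forall_exists_algHom_comp_eq ψ.hom hψ
  -- the points of `D(c)` come from the source
  have hopen : ∀ v : Z.toKGroup.obj K, (hz.desc v).hom c ≠ 0 →
      ∃ w : F'.obj K, ((toImage h).app K).hom w = v := by
    intro v hv
    obtain ⟨χ, hχ⟩ := hlift _ hv
    refine ⟨(F'.map (CommAlgCat.ofHom χ)).hom x', ?_⟩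
    rw [app_map_apply, ← hzx, ← map_comp_apply, ← hz.map_desc v]
    congr 3
    exact CommAlgCat.hom_ext hχ
  -- translation by `y'`, on coordinate algebras
  let η (S : CommAlgCat.{u} k) : K ⟶ S := CommAlgCat.ofHom (Algebra.ofId k S)
  have hη : ∀ (S : CommAlgCat.{u} k) (f : S ⟶ K), η S ≫ f = 𝟙 K := by
    intro S f
    refine CommAlgCat.hom_ext (AlgHom.ext fun a => ?_)
    exact f.hom.commutes a
  let τ : C ⟶ C := hz.desc ((Z.toKGroup.map (η C)).hom y' * z)
  have hτ : ∀ v : Z.toKGroup.obj K, hz.desc (y' * v) = τ ≫ hz.desc v := by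
    intro v
    refine hz.hom_ext ?_
    rw [hz.map_desc, map_comp_apply, hz.map_desc, map_mul, hz.map_desc, ← map_comp_apply, hη,
      map_id_apply]
  have hτc : τ.hom c ≠ 0 := by
    intro h0
    obtain ⟨χ, hχ⟩ := exists_algHom_apply_ne_zero k hc
    have e := hτ (y'⁻¹ * (Z.toKGroup.map (CommAlgCat.ofHom χ)).hom z)
    rw [mul_inv_cancel_left, show hz.desc ((Z.toKGroup.map (CommAlgCat.ofHom χ)).hom z) =
      CommAlgCat.ofHom χ from hz.hom_ext (hz.map_desc _)] at e
    refine hχ ?_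
    change (CommAlgCat.ofHom χ : C ⟶ K).hom c = 0
    rw [e]
    change (hz.desc _).hom (τ.hom c) = 0
    rw [h0, map_zero]
  obtain ⟨χ, hχ⟩ := exists_algHom_apply_ne_zero k
    (fun h0 => hτc (hψ (h0.trans (map_zero ψ.hom).symm)) : ψ.hom (τ.hom c) ≠ 0)
  let w : F'.obj K := (F'.map (CommAlgCat.ofHom χ)).hom x'
  have hw : hz.desc (((toImage h).app K).hom w) = ψ ≫ CommAlgCat.ofHom χ := by
    refine hz.hom_ext ?_
    rw [hz.map_desc, map_comp_apply, hzx, app_map_apply]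
    rfl
  obtain ⟨w', hw'⟩ := hopen (y' * ((toImage h).app K).hom w) (by
    rw [hτ, hw]; exact hχ)
  refine ⟨w' * w⁻¹, ?_⟩
  have : ((toImage h).app K).hom (w' * w⁻¹) = y' := by
    rw [map_mul, map_inv, hw', mul_inv_cancel_right]
  exact congrArg Subtype.val this

end Image

end KGroup

namespace KGroup

variable {k : Type u} [Field k]

/-! ### Coordinate algebras of `GL(Q)` and `U` -/

section ExtendScalars

variable {R S T : CommAlgCat.{u} k} (W : Type u) [AddCommGroup W] [Module k W]

/-- Extension of scalars `S ⊗ W → T ⊗ W` along `f : S ⟶ T`. -/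
noncomputable abbrev extendScalars (f : S ⟶ T) : S ⊗[k] W →ₗ[k] T ⊗[k] W :=
  f.hom.toLinearMap.rTensor W

variable {W}

lemma repr_extendScalars {ι : Type*} (b : Module.Basis ι k W) (f : S ⟶ T) (w : S ⊗[k] W) (i : ι) :
    (b.baseChange T).repr (extendScalars W f w) i = f.hom ((b.baseChange S).repr w i) := by
  induction w with
  | zero => simp
  | add x y hx hy => simp only [map_add, Finsupp.add_apply, hx, hy]
  | tmul s w => simp [Module.Basis.baseChange_repr_tmul]

variable {ι : Type*} [Fintype ι]

/-- The element of `S ⊗ W` with prescribed coordinates with respect to a basis of `W`. -/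
noncomputable def ofCoords (b : Module.Basis ι k W) (c : ι → S) : S ⊗[k] W :=
  (b.baseChange S).equivFun.symm c

lemma repr_ofCoords (b : Module.Basis ι k W) (c : ι → S) (i : ι) :
    (b.baseChange S).repr (ofCoords b c) i = c i := by
  rw [← Module.Basis.equivFun_apply, ofCoords, LinearEquiv.apply_symm_apply]

lemma extendScalars_ofCoords (b : Module.Basis ι k W) (c : ι → S) (f : S ⟶ T) :
    extendScalars W f (ofCoords b c) = ofCoords b fun i => f.hom (c i) := by
  refine (b.baseChange T).repr.injective (Finsupp.ext fun i => ?_)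
  rw [repr_extendScalars, repr_ofCoords, repr_ofCoords]

lemma ofCoords_repr (b : Module.Basis ι k W) (w : S ⊗[k] W) :
    ofCoords b (fun i => (b.baseChange S).repr w i) = w :=
  (b.baseChange S).repr.injective (Finsupp.ext fun i => repr_ofCoords b _ i)

end ExtendScalars

section GenLin

variable {Q : Type u} [AddCommGroup Q] [Module k Q]

lemma GenLin.ext {S : CommAlgCat.{u} k} {x y : (GenLin k Q).obj S} (h : val x = val y) : x = y :=
  Units.ext h

lemma val_map {S T : CommAlgCat.{u} k} (f : S ⟶ T) (x : (GenLin k Q).obj S) :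
    val (((GenLin k Q).map f).hom x) = extend f (val x) := rfl

lemma val_mul {S : CommAlgCat.{u} k} (x y : (GenLin k Q).obj S) :
    val (x * y) = val x * val y := rfl

lemma val_one {S : CommAlgCat.{u} k} : val (1 : (GenLin k Q).obj S) = 1 := rfl

lemma val_mul_val_inv {S : CommAlgCat.{u} k} (x : (GenLin k Q).obj S) : val x * val x⁻¹ = 1 :=
  Units.mul_inv (α := S ⊗[k] Module.End k Q) x

lemma val_inv_mul_val {S : CommAlgCat.{u} k} (x : (GenLin k Q).obj S) : val x⁻¹ * val x = 1 :=
  Units.inv_mul (α := S ⊗[k] Module.End k Q) x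

lemma extend_eq_extendScalars {S T : CommAlgCat.{u} k} (f : S ⟶ T)
    (x : S ⊗[k] Module.End k Q) : extend f x = extendScalars (Module.End k Q) f x := rfl

variable (k Q) in
/-- `GL(Q)` is an affine group scheme of finite type: with respect to a basis of `End(Q)`, a point
is a pair of coordinate vectors subject to the polynomial equations saying that the corresponding
operators are inverse to each other. -/
lemma exists_isUniversal_genLin [FiniteDimensional k Q] :
    ∃ (B : CommAlgCat.{u} k) (x : (GenLin k Q).obj B), Algebra.FiniteType k B ∧ IsUniversal x := by
  let b := Module.finBasis k (Module.End k Q)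
  let ι := Fin (Module.finrank k (Module.End k Q))
  let P : CommAlgCat.{u} k := CommAlgCat.of k (MvPolynomial (ι ⊕ ι) k)
  let X : P ⊗[k] Module.End k Q := ofCoords b fun i => (MvPolynomial.X (Sum.inl i) : P)
  let Y : P ⊗[k] Module.End k Q := ofCoords b fun i => (MvPolynomial.X (Sum.inr i) : P)
  let I : Ideal P := Ideal.span
    (Set.range (fun i => (b.baseChange P).repr (X * Y - 1) i) ∪
      Set.range fun i => (b.baseChange P).repr (Y * X - 1) i)
  let B : CommAlgCat.{u} k := CommAlgCat.of k (P ⧸ I)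
  let π : P ⟶ B := CommAlgCat.ofHom (Ideal.Quotient.mkₐ k I)
  have hπ : ∀ p ∈ I, π.hom p = 0 := fun p hp => Ideal.Quotient.eq_zero_iff_mem.2 hp
  have hXY : extend π X * extend π Y = 1 := by
    rw [← sub_eq_zero, ← map_mul, ← map_one (extend π), ← map_sub]
    refine (b.baseChange B).repr.injective (Finsupp.ext fun i => ?_)
    rw [extend_eq_extendScalars, repr_extendScalars, hπ _ (Ideal.subset_span (Or.inl ⟨i, rfl⟩))]
    simp
  have hYX : extend π Y * extend π X = 1 := by
    rw [← sub_eq_zero, ← map_mul, ← map_one (extend π), ← map_sub]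
    refine (b.baseChange B).repr.injective (Finsupp.ext fun i => ?_)
    rw [extend_eq_extendScalars, repr_extendScalars, hπ _ (Ideal.subset_span (Or.inr ⟨i, rfl⟩))]
    simp
  let x : (GenLin k Q).obj B := (⟨extend π X, extend π Y, hXY, hYX⟩ : (B ⊗[k] Module.End k Q)ˣ)
  have hx : ∀ {S : CommAlgCat.{u} k} (φ : B ⟶ S),
      val (((GenLin k Q).map φ).hom x) =
        ofCoords b (fun i => φ.hom (π.hom (MvPolynomial.X (Sum.inl i)))) ∧
      val (((GenLin k Q).map φ).hom x)⁻¹ =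
        ofCoords b (fun i => φ.hom (π.hom (MvPolynomial.X (Sum.inr i)))) := by
    intro S φ
    constructor
    · change extend φ (extend π X) = _
      rw [extend_eq_extendScalars, extend_eq_extendScalars, extendScalars_ofCoords,
        extendScalars_ofCoords]
    · rw [← map_inv]
      change extend φ (extend π Y) = _
      rw [extend_eq_extendScalars, extend_eq_extendScalars, extendScalars_ofCoords,
        extendScalars_ofCoords]
  refine ⟨B, x, inferInstanceAs (Algebra.FiniteType k (MvPolynomial (ι ⊕ ι) k ⧸ I)), fun S y => ?_⟩
  let γ : P ⟶ S := CommAlgCat.ofHom (MvPolynomial.aeval (Sum.elim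
    (fun i => (b.baseChange S).repr (val y) i) (fun i => (b.baseChange S).repr (val y⁻¹) i)))
  have hγl : ∀ i, γ.hom (MvPolynomial.X (Sum.inl i)) = (b.baseChange S).repr (val y) i :=
    fun i => MvPolynomial.aeval_X _ _
  have hγr : ∀ i, γ.hom (MvPolynomial.X (Sum.inr i)) = (b.baseChange S).repr (val y⁻¹) i :=
    fun i => MvPolynomial.aeval_X _ _
  have hγX : extend γ X = val y := by
    rw [extend_eq_extendScalars, extendScalars_ofCoords]
    simp only [hγl]
    exact ofCoords_repr b _
  have hγY : extend γ Y = val y⁻¹ := by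
    rw [extend_eq_extendScalars, extendScalars_ofCoords]
    simp only [hγr]
    exact ofCoords_repr b _
  have hγI : ∀ p ∈ I, γ.hom p = 0 := by
    intro p hp
    refine (Ideal.span_le (I := RingHom.ker γ.hom)).2 ?_ hp
    rintro _ (⟨i, rfl⟩ | ⟨i, rfl⟩)
    · change γ.hom _ = 0
      rw [← repr_extendScalars, ← extend_eq_extendScalars, map_sub, map_mul, hγX, hγY,
        val_mul_val_inv, map_one, sub_self, map_zero, Finsupp.zero_apply]
    · change γ.hom _ = 0
      rw [← repr_extendScalars, ← extend_eq_extendScalars, map_sub, map_mul, hγX, hγY,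
        val_inv_mul_val, map_one, sub_self, map_zero, Finsupp.zero_apply]
  let φ : B ⟶ S := CommAlgCat.ofHom (Ideal.Quotient.liftₐ I γ.hom hγI)
  have hφ : ∀ p, φ.hom (π.hom p) = γ.hom p := fun p => rfl
  refine ⟨φ, GenLin.ext ?_, fun ψ hψ => ?_⟩
  · rw [(hx φ).1]
    simp only [hφ, hγl]
    exact ofCoords_repr b _
  · have e : π ≫ ψ = π ≫ φ := by
      refine CommAlgCat.hom_ext (MvPolynomial.algHom_ext ?_)
      rintro (i | i)
      · change ψ.hom (π.hom _) = φ.hom (π.hom _)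
        rw [hφ, hγl, ← hψ, (hx ψ).1, repr_ofCoords]
      · change ψ.hom (π.hom _) = φ.hom (π.hom _)
        rw [hφ, hγr, ← hψ, (hx ψ).2, repr_ofCoords]
    refine CommAlgCat.hom_ext (AlgHom.ext fun c => ?_)
    obtain ⟨p, rfl⟩ := Ideal.Quotient.mk_surjective c
    exact ConcreteCategory.congr_hom e p

end GenLin

section Unipotent

variable {G : KGroup k} {N : SubgroupFunctor G} {Q : Type u} [AddCommGroup Q] [Module k Q]

lemma mem_unipotent_iff {ρ : N.toKGroup ⟶ GenLin k Q} {V : Submodule k Q} {S : CommAlgCat.{u} k}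
    {y : (GenLin k Q).obj S} :
    y ∈ (unipotent ρ V).pts S ↔ val y - 1 ∈ (annihilator ρ V).baseChange S := Iff.rfl

/-- If `J_V` is nilpotent, then `U = 1 + J_V` is an affine space as a scheme. -/
lemma exists_isUniversal_unipotent [FiniteDimensional k Q] (ρ : N.toKGroup ⟶ GenLin k Q)
    (V : Submodule k Q) (hnil : ∀ (S : CommAlgCat.{u} k) (x : S ⊗[k] Module.End k Q),
      x ∈ (annihilator ρ V).baseChange S → IsNilpotent x) :
    ∃ (d : ℕ) (x : (unipotent ρ V).toKGroup.obj (CommAlgCat.of k (MvPolynomial (Fin d) k))),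
      IsUniversal x := by
  let J := annihilator ρ V
  let b := Module.finBasis k J
  let P : CommAlgCat.{u} k := CommAlgCat.of k (MvPolynomial (Fin (Module.finrank k J)) k)
  let j : P ⊗[k] J := ofCoords b fun i => (MvPolynomial.X i : P)
  have hj : J.subtype.baseChange P j ∈ J.baseChange P := ⟨j, rfl⟩
  have hu := (hnil P _ hj).isUnit_one_add
  let y : (GenLin k Q).obj P := hu.unit
  have hy : val y - 1 = J.subtype.baseChange P j := add_sub_cancel_left _ _
  let x : (unipotent ρ V).toKGroup.obj P := ⟨y, mem_unipotent_iff.2 (by rw [hy]; exact hj)⟩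
  have hinj : ∀ S : CommAlgCat.{u} k, Function.Injective (J.subtype.baseChange S) := fun S =>
    Module.Flat.lTensor_preserves_injective_linearMap J.subtype J.injective_subtype
  have hext : ∀ {S T : CommAlgCat.{u} k} (f : S ⟶ T) (w : S ⊗[k] J),
      extend f (J.subtype.baseChange S w) = J.subtype.baseChange T (extendScalars J f w) := by
    intro S T f w
    induction w with
    | zero => simp
    | add x y hx hy => simp only [map_add, hx, hy]
    | tmul s w => simp
  have hx : ∀ {S : CommAlgCat.{u} k} (φ : P ⟶ S),
      val (((unipotent ρ V).toKGroup.map φ).hom x).1 - 1 =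
        J.subtype.baseChange S (ofCoords b fun i => φ.hom (MvPolynomial.X i)) := by
    intro S φ
    change extend φ (1 + J.subtype.baseChange P j) - 1 = _
    rw [map_add, map_one, add_sub_cancel_left, hext, extendScalars_ofCoords]
  refine ⟨_, x, fun S y => ?_⟩
  obtain ⟨w, hw⟩ := mem_unipotent_iff.1 y.2
  refine ⟨CommAlgCat.ofHom (MvPolynomial.aeval fun i => (b.baseChange S).repr w i),
    Subtype.ext (GenLin.ext (sub_left_injective (b := 1) ?_)), fun ψ hψ => ?_⟩
  · dsimp only
    rw [hx, ← hw]
    congr 1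
    convert! ofCoords_repr b w using 3 with i
    exact MvPolynomial.aeval_X _ _
  · refine CommAlgCat.hom_ext (MvPolynomial.algHom_ext fun i => ?_)
    have e := hx ψ
    rw [hψ, ← hw] at e
    have e' := congrArg (fun v => (b.baseChange S).repr v i) (hinj S e)
    rw [repr_ofCoords] at e'
    exact e'.symm.trans (MvPolynomial.aeval_X _ _).symm

end Unipotent

end KGroup

/-! ### Nilpotence of `J_V` -/

/-- A left ideal consisting of nilpotent elements lies in the Jacobson radical. -/
lemma Ideal.le_jacobson_of_forall_isNilpotent {R : Type*} [Ring R] {I : Ideal R}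
    (hI : ∀ x ∈ I, IsNilpotent x) : I ≤ Ring.jacobson R := by
  intro x hx
  rw [← Ideal.jacobson_bot, Ideal.mem_jacobson_iff]
  intro y
  obtain ⟨v, hv⟩ := (hI (y * x) (I.mul_mem_left y hx)).isUnit_one_add
  refine ⟨(v⁻¹ : Rˣ), ?_⟩
  have e : (v⁻¹ : Rˣ) * (1 + y * x) = 1 := by rw [← hv, Units.inv_mul]
  rw [Ideal.mem_bot, sub_eq_zero, ← e, mul_add, mul_one, mul_assoc, add_comm]

/-- A subspace of nilpotent elements of a finite dimensional algebra, which is the image of a left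
ideal of a subalgebra, is nilpotent. -/
lemma Submodule.exists_pow_eq_bot_of_forall_isNilpotent {k E : Type*} [Field k] [Ring E]
    [Algebra k E] [FiniteDimensional k E] (C : Subalgebra k E) (J : Submodule k E)
    (hJC : ∀ x ∈ J, x ∈ C) (hmul : ∀ c ∈ C, ∀ x ∈ J, c * x ∈ J) (hnil : ∀ x ∈ J, IsNilpotent x) :
    ∃ n : ℕ, J ^ n = ⊥ := by
  have : IsArtinianRing C := IsArtinianRing.of_finite k C
  let I : Ideal C :=
    { carrier := {c | (c : E) ∈ J}
      zero_mem' := J.zero_mem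
      add_mem' := J.add_mem
      smul_mem' := fun c x hx => hmul c c.2 x hx }
  have hI : I ≤ Ring.jacobson C := Ideal.le_jacobson_of_forall_isNilpotent fun x hx => by
    obtain ⟨n, hn⟩ := hnil x hx
    exact ⟨n, Subtype.ext hn⟩
  obtain ⟨n, hn⟩ := IsSemiprimaryRing.isNilpotent (R := C)
  let M : Submodule k C := (Ring.jacobson C).restrictScalars k
  have hM : ∀ m, M ^ m ≤ ((Ring.jacobson C) ^ m).restrictScalars k := by
    intro m
    induction m with
    | zero =>
      intro x _
      change x ∈ Ring.jacobson C ^ 0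
      rw [Submodule.pow_zero, Ideal.one_eq_top]
      trivial
    | succ m ih =>
      rw [pow_succ', Submodule.mul_le]
      intro a ha b hb
      change a * b ∈ Ring.jacobson C ^ (m + 1)
      rw [Ideal.IsTwoSided.pow_succ]
      exact Ideal.mul_mem_mul ha (ih hb)
  refine ⟨n, le_bot_iff.1 ?_⟩
  have hJ : J ≤ M.map C.val.toLinearMap := fun x hx => ⟨⟨x, hJC x hx⟩, hI hx, rfl⟩
  refine (pow_le_pow_left' hJ n).trans ?_
  rw [← Submodule.map_pow, Submodule.map_le_iff_le_comap]
  intro x hx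
  have := hM n hx
  rw [hn] at this
  have h0 : x = 0 := this
  rw [h0]
  exact zero_mem _

namespace KGroup

variable {k : Type u} [Field k]

lemma mul_mem_baseChange_mul {E : Type u} [Ring E] [Algebra k E] {S : CommAlgCat.{u} k}
    {M M' : Submodule k E} {x y : S ⊗[k] E} (hx : x ∈ M.baseChange S) (hy : y ∈ M'.baseChange S) :
    x * y ∈ (M * M').baseChange S := by
  obtain ⟨x, rfl⟩ := hx
  obtain ⟨y, rfl⟩ := hy
  induction x with
  | zero => simp
  | add x x' hx hx' => rw [map_add, add_mul]; exact add_mem hx hx'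
  | tmul s m =>
    induction y with
    | zero => simp
    | add y y' hy hy' => rw [map_add, mul_add]; exact add_mem hy hy'
    | tmul t m' =>
      simp only [LinearMap.baseChange_tmul, Submodule.subtype_apply,
        Algebra.TensorProduct.tmul_mul_tmul]
      exact Submodule.tmul_mem_baseChange_of_mem _ (Submodule.mul_mem_mul m.2 m'.2)

section Annihilator

variable {G : KGroup k} {N : SubgroupFunctor G} {Q : Type u} [AddCommGroup Q] [Module k Q]
  {ρ : N.toKGroup ⟶ GenLin k Q} {V : Submodule k Q}

/-- The range of an endomorphism of the `N`-module `Q` is a submodule. -/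
lemma isSubmodule_range {φ : Module.End k Q} (hφ : ∀ (S : CommAlgCat.{u} k) (n : N.pts S),
    (1 ⊗ₜ[k] φ : S ⊗[k] Module.End k Q) * op ρ n = op ρ n * (1 ⊗ₜ[k] φ)) :
    IsSubmodule ρ (LinearMap.range φ) := by
  intro S n w hw
  have h1 : ∀ z : S ⊗[k] Q, act (1 ⊗ₜ[k] φ) z ∈ (LinearMap.range φ).baseChange S := by
    intro z
    induction z with
    | zero => simp
    | add x y hx hy => rw [map_add]; exact add_mem hx hy
    | tmul s q =>
      rw [act_tmul]
      exact Submodule.tmul_mem_baseChange_of_mem _ ⟨q, rfl⟩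
  have h2 : ∃ z : S ⊗[k] Q, act (1 ⊗ₜ[k] φ) z = w := by
    obtain ⟨w, rfl⟩ := hw
    induction w with
    | zero => exact ⟨0, by simp⟩
    | add x y hx hy =>
      obtain ⟨a, ha⟩ := hx
      obtain ⟨b, hb⟩ := hy
      exact ⟨a + b, by rw [map_add, ha, hb, map_add]⟩
    | tmul s w =>
      obtain ⟨_, q, rfl⟩ := w
      exact ⟨s ⊗ₜ q, by simp⟩
  obtain ⟨z, rfl⟩ := h2
  rw [← Module.End.mul_apply, ← map_mul, ← hφ, map_mul, Module.End.mul_apply]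
  exact h1 _

lemma exists_simple_le [FiniteDimensional k Q] {W : Submodule k Q} (hW : IsSubmodule ρ W)
    (h0 : W ≠ ⊥) : ∃ T ≤ W, T ≠ ⊥ ∧ T ≤ socle ρ := by
  obtain ⟨T, ⟨hT, hT0, hTW⟩, hmin⟩ := wellFounded_lt.has_min
    {T : Submodule k Q | IsSubmodule ρ T ∧ T ≠ ⊥ ∧ T ≤ W} ⟨W, hW, h0, le_rfl⟩
  refine ⟨T, hTW, hT0, le_sSup ⟨hT, hT0, fun W' hW' hs => ?_⟩⟩
  by_contra! h
  exact hmin W' ⟨hs, h.1, hW'.trans hTW⟩ (lt_of_le_of_ne hW' h.2)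

/-- If `V` contains the socle of `Q`, an endomorphism of `Q` which kills `V` is nilpotent: it would
be injective on the eventual range of its powers, which would contain a simple submodule. -/
lemma isNilpotent_of_mem_annihilator [FiniteDimensional k Q] (hsoc : socle ρ ≤ V)
    {φ : Module.End k Q} (hφ : φ ∈ annihilator ρ V) : IsNilpotent φ := by
  obtain ⟨n, hn⟩ := Filter.eventually_atTop.1 (Module.End.eventually_disjoint_ker_pow_range_pow φ)
  have hd := hn (n + 1) n.le_succ
  refine ⟨n + 1, ?_⟩
  by_contra h0
  have hsub : IsSubmodule ρ (LinearMap.range (φ ^ (n + 1))) := isSubmodule_range fun S m => by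
    have := (show Commute ((1 : S) ⊗ₜ[k] φ) (op ρ m) from hφ.1 S m).pow_left (n + 1)
    rwa [Algebra.TensorProduct.tmul_pow, one_pow] at this
  obtain ⟨T, hT, hT0, hTs⟩ := exists_simple_le hsub (by rwa [Ne, LinearMap.range_eq_bot])
  obtain ⟨t, ht, ht0⟩ := Submodule.exists_mem_ne_zero_of_ne_bot hT0
  refine ht0 (Submodule.disjoint_def.1 hd t ?_ (hT ht))
  rw [LinearMap.mem_ker, pow_succ, Module.End.mul_apply, hφ.2 t (hsoc (hTs ht)), map_zero]

lemma isNilpotent_of_mem_annihilator_baseChange [FiniteDimensional k Q] (hsoc : socle ρ ≤ V)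
    {S : CommAlgCat.{u} k} {x : S ⊗[k] Module.End k Q}
    (hx : x ∈ (annihilator ρ V).baseChange S) : IsNilpotent x := by
  let C : Subalgebra k (Module.End k Q) :=
    { carrier := {φ | ∀ (S : CommAlgCat.{u} k) (n : N.pts S),
        Commute (1 ⊗ₜ[k] φ : S ⊗[k] Module.End k Q) (op ρ n)}
      mul_mem' := fun {a b} ha hb S n => by
        have := (ha S n).mul_left (hb S n)
        rwa [Algebra.TensorProduct.tmul_mul_tmul, one_mul] at this
      add_mem' := fun {a b} ha hb S n => by
        rw [TensorProduct.tmul_add]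
        exact (ha S n).add_left (hb S n)
      algebraMap_mem' := fun c S n => by
        rw [Algebra.algebraMap_eq_smul_one, TensorProduct.tmul_smul]
        exact (Commute.one_left _).smul_left c }
  obtain ⟨n, hn⟩ := Submodule.exists_pow_eq_bot_of_forall_isNilpotent C (annihilator ρ V)
    (fun φ hφ => hφ.1)
    (fun c hc φ hφ => ⟨fun S m => by
        have := (hc S m).mul_left (show Commute _ _ from hφ.1 S m)
        rwa [Algebra.TensorProduct.tmul_mul_tmul, one_mul] at this,
      fun v hv => by rw [Module.End.mul_apply, hφ.2 v hv, map_zero]⟩)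
    (fun φ hφ => isNilpotent_of_mem_annihilator hsoc hφ)
  have key : ∀ m, x ^ m ∈ (annihilator ρ V ^ m).baseChange S := by
    intro m
    induction m with
    | zero =>
      rw [pow_zero, pow_zero, Algebra.TensorProduct.one_def]
      exact Submodule.tmul_mem_baseChange_of_mem _ (Submodule.one_le.1 le_rfl)
    | succ m ih =>
      rw [pow_succ, pow_succ]
      exact mul_mem_baseChange_mul ih hx
  have := key n
  rw [hn, Submodule.baseChange_bot] at this
  exact ⟨n, this⟩

end Annihilator

end KGroup

namespace KGroup

variable {k : Type u} [Field k]

/-! ### Representations on stable subspaces -/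

section Representations

variable {S T : CommAlgCat.{u} k} {W : Type u} [AddCommGroup W] [Module k W] (X : Submodule k W)

lemma act_extend (f : S ⟶ T) (x : S ⊗[k] Module.End k W) (w : S ⊗[k] W) :
    act (extend f x) (extendScalars W f w) = extendScalars W f (act x w) := by
  induction x with
  | zero => simp
  | add x y hx hy => simp only [map_add, LinearMap.add_apply, hx, hy]
  | tmul s φ =>
    induction w with
    | zero => simp
    | add x y hx hy => simp only [map_add, hx, hy]
    | tmul t w => simp

lemma incl_extendScalars (f : S ⟶ T) (w : S ⊗[k] X) :
    incl X T (extendScalars X f w) = extendScalars W f (incl X S w) := by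
  induction w with
  | zero => simp
  | add x y hx hy => simp only [map_add, hx, hy]
  | tmul s w => simp

lemma incl_injective (S : CommAlgCat.{u} k) : Function.Injective (incl X S) :=
  Module.Flat.lTensor_preserves_injective_linearMap X.subtype X.injective_subtype

/-- A linear projection of `W` onto the subspace `X`. -/
noncomputable def retraction : W →ₗ[k] X :=
  (X.subtype.exists_leftInverse_of_injective (LinearMap.ker_eq_bot.2 X.injective_subtype)).choose

lemma retraction_comp_subtype : retraction X ∘ₗ X.subtype = LinearMap.id :=
  (X.subtype.exists_leftInverse_of_injective
    (LinearMap.ker_eq_bot.2 X.injective_subtype)).choose_spec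

variable {X} in
lemma incl_retraction {w : S ⊗[k] W} (hw : w ∈ X.baseChange S) :
    incl X S ((retraction X).baseChange S w) = w := by
  obtain ⟨w, rfl⟩ := hw
  have e : (retraction X).baseChange S (incl X S w) = w := by
    rw [← LinearMap.comp_apply, ← LinearMap.baseChange_comp, retraction_comp_subtype,
      LinearMap.baseChange_id, LinearMap.id_apply]
  exact congrArg (incl X S) e

variable {X} in
lemma map_mem_baseChange {Y : Submodule S (S ⊗[k] W)} {ψ : S ⊗[k] W →ₗ[S] S ⊗[k] W}
    (h : ∀ x ∈ X, ψ (1 ⊗ₜ[k] x) ∈ Y) {w : S ⊗[k] W} (hw : w ∈ X.baseChange S) : ψ w ∈ Y := by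
  obtain ⟨w, rfl⟩ := hw
  induction w with
  | zero => simp
  | add x y hx hy => rw [map_add, map_add]; exact add_mem hx hy
  | tmul s x =>
    have e : X.subtype.baseChange S (s ⊗ₜ[k] x) = s • ((1 : S) ⊗ₜ[k] (x : W)) := by
      simp [TensorProduct.smul_tmul']
    rw [e, map_smul]
    exact Y.smul_mem s (h x x.2)

variable {F F' : KGroup k}

/-- If the image of `h : F' ⟶ F` stabilizes a subspace `X` of a representation `W` of `F`, then so
does its closure, the defining equations of the stabilizer being regular functions on `F`. -/
lemma mem_baseChange_of_mem_image (h : F' ⟶ F)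
    {a : ∀ S : CommAlgCat.{u} k, F.obj S →* Module.End S (S ⊗[k] W)}
    (ha : ∀ {S T : CommAlgCat.{u} k} (f : S ⟶ T) (y : F.obj S) (w : S ⊗[k] W),
      a T ((F.map f).hom y) (extendScalars W f w) = extendScalars W f (a S y w))
    (hX : ∀ (S : CommAlgCat.{u} k) (x : F'.obj S), ∀ v ∈ X,
      a S ((h.app S).hom x) (1 ⊗ₜ[k] v) ∈ X.baseChange S)
    {y : F.obj S} (hy : y ∈ (SubgroupFunctor.image h).pts S) {v : W} (hv : v ∈ X) :
    a S y (1 ⊗ₜ[k] v) ∈ X.baseChange S := by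
  let b := Module.Basis.ofVectorSpace k W
  let π : W →ₗ[k] W := LinearMap.id - X.subtype ∘ₗ retraction X
  have hπ : ∀ (S : CommAlgCat.{u} k) (w : S ⊗[k] W),
      π.baseChange S w = w - incl X S ((retraction X).baseChange S w) := by
    intro S w
    rw [LinearMap.baseChange_sub, LinearMap.baseChange_id, LinearMap.baseChange_comp]
    rfl
  let r (i) : RegularFunction F :=
    { toFun := fun S y => (b.baseChange S).repr (π.baseChange S (a S y (1 ⊗ₜ[k] v))) i
      naturality := fun {S T} f y => by
        have e1 : ((1 : T) ⊗ₜ[k] v) = extendScalars W f ((1 : S) ⊗ₜ[k] v) := by simp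
        have e2 : ∀ w : S ⊗[k] W,
            π.baseChange T (extendScalars W f w) = extendScalars W f (π.baseChange S w) := by
          intro w
          induction w with
          | zero => simp
          | add x y hx hy => simp only [map_add, hx, hy]
          | tmul s w => simp
        rw [e1, ha, e2, repr_extendScalars] }
  have hr : ∀ i, VanishesOn h (r i) := by
    intro i T x
    change (b.baseChange T).repr (π.baseChange T _) i = 0
    rw [hπ, incl_retraction (hX T x v hv), sub_self, map_zero, Finsupp.zero_apply]
  have h0 : π.baseChange S (a S y (1 ⊗ₜ[k] v)) = 0 :=
    (b.baseChange S).repr.injective (Finsupp.ext fun i => by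
      rw [map_zero, Finsupp.zero_apply]
      exact (mem_image_iff h).1 hy (r i) (hr i))
  rw [hπ, sub_eq_zero] at h0
  exact ⟨(retraction X).baseChange S (a S y (1 ⊗ₜ[k] v)), h0.symm⟩

/-- A subspace `X` which is stable under a representation `a` of `F` on `W` is a representation. -/
lemma exists_hom_genLin [FiniteDimensional k X]
    {a : ∀ S : CommAlgCat.{u} k, F.obj S →* Module.End S (S ⊗[k] W)}
    (ha : ∀ {S T : CommAlgCat.{u} k} (f : S ⟶ T) (y : F.obj S) (w : S ⊗[k] W),
      a T ((F.map f).hom y) (extendScalars W f w) = extendScalars W f (a S y w))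
    (hX : ∀ (S : CommAlgCat.{u} k) (y : F.obj S), ∀ v ∈ X, a S y (1 ⊗ₜ[k] v) ∈ X.baseChange S) :
    ∃ τ : F ⟶ GenLin k X, ∀ (S : CommAlgCat.{u} k) (y : F.obj S) (w : S ⊗[k] X),
      incl X S (act (val ((τ.app S).hom y)) w) = a S y (incl X S w) := by
  let r (S : CommAlgCat.{u} k) (y : F.obj S) : Module.End S (S ⊗[k] X) :=
    (retraction X).baseChange S ∘ₗ a S y ∘ₗ incl X S
  have hr : ∀ (S : CommAlgCat.{u} k) (y : F.obj S) (w : S ⊗[k] X),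
      incl X S (r S y w) = a S y (incl X S w) := fun S y w =>
    incl_retraction (map_mem_baseChange (hX S y) ⟨w, rfl⟩)
  let rh (S : CommAlgCat.{u} k) : F.obj S →* Module.End S (S ⊗[k] X) :=
    { toFun := r S
      map_one' := LinearMap.ext fun w => incl_injective X S (by rw [hr, map_one]; rfl)
      map_mul' := fun y z => LinearMap.ext fun w => incl_injective X S (by
        rw [hr, map_mul, Module.End.mul_apply, Module.End.mul_apply, hr, hr]) }
  let e (S : CommAlgCat.{u} k) : S ⊗[k] Module.End k X ≃ₐ[S] Module.End S (S ⊗[k] X) :=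
    AlgEquiv.ofBijective act (act_bijective S)
  let t (S : CommAlgCat.{u} k) : F.obj S →* (S ⊗[k] Module.End k X)ˣ :=
    MonoidHom.toHomUnits (((e S).symm : _ →* _).comp (rh S))
  have ht : ∀ (S : CommAlgCat.{u} k) (y : F.obj S),
      act (val (t S y : (GenLin k X).obj S)) = r S y := fun S y =>
    (e S).apply_symm_apply (r S y)
  have ht' : ∀ (S : CommAlgCat.{u} k) (y : F.obj S) (w : S ⊗[k] X),
      incl X S (act (val (t S y : (GenLin k X).obj S)) w) = a S y (incl X S w) := fun S y w => by
    rw [ht, hr]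
  refine ⟨{ app := fun S => GrpCat.ofHom (t S), naturality := fun S T f => ?_ }, ht'⟩
  refine GrpCat.ext fun y => GenLin.ext ((act_bijective T).1 ?_)
  refine TensorProduct.AlgebraTensorModule.curry_injective ?_
  refine LinearMap.ext_ring (LinearMap.ext fun x => incl_injective X T ?_)
  have e1 : ((1 : T) ⊗ₜ[k] x) = extendScalars X f ((1 : S) ⊗ₜ[k] x) := by simp
  change incl X T (act (val (t T ((F.map f).hom y) : (GenLin k X).obj T)) ((1 : T) ⊗ₜ[k] x)) =
    incl X T (act (extend f (val (t S y : (GenLin k X).obj S))) ((1 : T) ⊗ₜ[k] x))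
  rw [ht', e1, act_extend, incl_extendScalars, incl_extendScalars, ha, ht']

lemma val_eq_one_iff [FiniteDimensional k X] {y : (GenLin k X).obj S}
    {ψ : S ⊗[k] W →ₗ[S] S ⊗[k] W} (hy : ∀ w, incl X S (act (val y) w) = ψ (incl X S w)) :
    y = 1 ↔ ∀ x ∈ X, ψ (1 ⊗ₜ[k] x) = 1 ⊗ₜ[k] x := by
  have hincl : ∀ x : X, incl X S (1 ⊗ₜ[k] x) = 1 ⊗ₜ[k] (x : W) := fun x => by simp
  constructor
  · rintro rfl x hx
    have := hy (1 ⊗ₜ[k] ⟨x, hx⟩)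
    rw [val_one, map_one, Module.End.one_apply, hincl] at this
    exact this.symm
  · intro h
    refine GenLin.ext ((act_bijective S).1 ?_)
    refine TensorProduct.AlgebraTensorModule.curry_injective ?_
    refine LinearMap.ext_ring (LinearMap.ext fun x => incl_injective X S ?_)
    change incl X S (act (val y) ((1 : S) ⊗ₜ[k] x)) =
      incl X S (act (val (1 : (GenLin k X).obj S)) ((1 : S) ⊗ₜ[k] x))
    rw [hy, val_one, map_one, Module.End.one_apply, hincl, h x x.2]

end Representations

/-! ### The span of the operators of `N` -/

section OperatorSpan

variable {G : KGroup k} {N : SubgroupFunctor G} {Q : Type u} [AddCommGroup Q] [Module k Q]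
  (ρ : N.toKGroup ⟶ GenLin k Q)

lemma mem_baseChange_of_slice_mem {S : CommAlgCat.{u} k} {W : Type u} [AddCommGroup W] [Module k W]
    {X : Submodule k W} {w : S ⊗[k] W} (h : ∀ c : S →ₗ[k] k, slice c W w ∈ X) :
    w ∈ X.baseChange S := by
  have e : ∀ c : S →ₗ[k] k, slice c W (w - X.subtype.baseChange S
      ((retraction X).baseChange S w)) = 0 := by
    intro c
    have e1 : ∀ w : S ⊗[k] W, slice c W (X.subtype.baseChange S ((retraction X).baseChange S w)) =
        retraction X (slice c W w) := by
      intro w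
      induction w with
      | zero => simp
      | add x y hx hy => simp only [map_add, hx, hy, Submodule.coe_add]
      | tmul s w => simp
    have e2 : (retraction X (slice c W w) : W) = slice c W w :=
      congrArg Subtype.val (LinearMap.congr_fun (retraction_comp_subtype X) ⟨_, h c⟩)
    rw [map_sub, e1, e2, sub_self]
  have := eq_zero_of_slice_eq_zero e
  rw [sub_eq_zero] at this
  exact ⟨_, this.symm⟩

/-- The subspace of `End_k(Q)` spanned by the operators by which `N` acts: the smallest subspace
`R` such that every point `n ∈ N(S)` acts through an element of `S ⊗ R`. -/
def operatorSpan : Submodule k (Module.End k Q) :=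
  Submodule.span k {φ | ∃ (S : CommAlgCat.{u} k) (n : N.pts S) (c : S →ₗ[k] k),
    φ = slice c (Module.End k Q) (op ρ n)}

lemma op_mem_baseChange {S : CommAlgCat.{u} k} (n : N.pts S) :
    op ρ n ∈ (operatorSpan ρ).baseChange S :=
  mem_baseChange_of_slice_mem fun c => Submodule.subset_span ⟨S, n, c, rfl⟩

variable {ρ} in
/-- Commuting with all operators of `N`, universally, is the same as commuting with their span. -/
lemma forall_commute_op_iff {S : CommAlgCat.{u} k} {y : S ⊗[k] Module.End k Q} :
    (∀ (T : CommAlgCat.{u} k) (f : S ⟶ T) (n : N.pts T),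
      extend f y * op ρ n = op ρ n * extend f y) ↔
    ∀ φ ∈ operatorSpan ρ, (1 ⊗ₜ[k] φ : S ⊗[k] Module.End k Q) * y = y * (1 ⊗ₜ[k] φ) := by
  constructor
  · intro h φ hφ
    induction hφ using Submodule.span_induction with
    | mem φ hφ =>
      obtain ⟨T, n, c, rfl⟩ := hφ
      refine slice_comm c (op ρ n) y ?_
      rw [← op_map ρ]
      exact (h _ _ _).symm
    | zero => simp
    | add a b _ _ ha hb => rw [TensorProduct.tmul_add, add_mul, mul_add, ha, hb]
    | smul c a _ ha => rw [TensorProduct.tmul_smul, smul_mul_assoc, mul_smul_comm, ha]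
  · intro h T f n
    have hψ : ∀ φ ∈ operatorSpan ρ,
        (LinearMap.mulLeft T (extend f y) - LinearMap.mulRight T (extend f y)) (1 ⊗ₜ[k] φ) ∈
          (⊥ : Submodule T (T ⊗[k] Module.End k Q)) := by
      intro φ hφ
      have e : (1 ⊗ₜ[k] φ : T ⊗[k] Module.End k Q) = extend f (1 ⊗ₜ[k] φ) := by simp
      rw [Submodule.mem_bot, LinearMap.sub_apply, LinearMap.mulLeft_apply,
        LinearMap.mulRight_apply, e, ← map_mul, ← map_mul, h φ hφ, sub_self]
    have := map_mem_baseChange hψ (op_mem_baseChange ρ n)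
    rwa [Submodule.mem_bot, LinearMap.sub_apply, LinearMap.mulLeft_apply,
        LinearMap.mulRight_apply, sub_eq_zero] at this

/-- `U` is the subgroup of `GL(Q)` of elements which act trivially on `V` and on the span of the
operators of `N` by conjugation. -/
lemma mem_unipotent_iff_act_eq {ρ : N.toKGroup ⟶ GenLin k Q} {V : Submodule k Q}
    {S : CommAlgCat.{u} k} {y : (GenLin k Q).obj S} :
    y ∈ (unipotent ρ V).pts S ↔ (∀ v ∈ V, act (val y) (1 ⊗ₜ[k] v) = 1 ⊗ₜ[k] v) ∧
      ∀ φ ∈ operatorSpan ρ, val y * (1 ⊗ₜ[k] φ) * val y⁻¹ = 1 ⊗ₜ[k] φ := by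
  rw [mem_unipotent_iff, mem_annihilator_baseChange, forall_commute_op_iff, and_comm]
  refine and_congr (forall₂_congr fun v _ => ?_) (forall₂_congr fun φ _ => ?_)
  · rw [map_sub, map_one, LinearMap.sub_apply, sub_eq_zero]; rfl
  · rw [mul_sub, sub_mul, mul_one, one_mul, sub_left_inj]
    constructor
    · intro h
      rw [← h, mul_assoc, val_mul_val_inv, mul_one]
    · intro h
      conv_lhs => rw [← h]
      rw [mul_assoc, val_inv_mul_val, mul_one]

lemma rTensor_slice_conj {S T : CommAlgCat.{u} k} (c : T →ₗ[k] k)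
    (x : T ⊗[k] Module.End k Q) (y z : S ⊗[k] Module.End k Q) :
    (slice c S).rTensor (Module.End k Q)
      (extend (CommAlgCat.ofHom Algebra.TensorProduct.includeRight :
          S ⟶ CommAlgCat.of k (T ⊗[k] S)) y *
        extend (CommAlgCat.ofHom Algebra.TensorProduct.includeLeft :
          T ⟶ CommAlgCat.of k (T ⊗[k] S)) x *
        extend (CommAlgCat.ofHom Algebra.TensorProduct.includeRight :
          S ⟶ CommAlgCat.of k (T ⊗[k] S)) z) =
      y * (1 ⊗ₜ[k] slice c (Module.End k Q) x) * z := by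
  induction x with
  | zero => simp
  | add x x' hx hx' =>
    simp only [map_add, add_mul, mul_add, TensorProduct.tmul_add, hx, hx']
  | tmul t φ =>
    induction y with
    | zero => simp
    | add y y' hy hy' => simp only [map_add, add_mul, hy, hy']
    | tmul s ψ =>
      induction z with
      | zero => simp
      | add z z' hz hz' => simp only [map_add, mul_add, hz, hz']
      | tmul s' ψ' =>
        rw [slice_tmul, TensorProduct.tmul_smul, mul_smul_comm, smul_mul_assoc]
        simp [← TensorProduct.smul_tmul']

lemma rTensor_slice_mem_baseChange {S T : CommAlgCat.{u} k} (c : T →ₗ[k] k) {W : Type u}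
    [AddCommGroup W] [Module k W] {X : Submodule k W} {w : (T ⊗[k] S) ⊗[k] W}
    (hw : w ∈ X.baseChange (T ⊗[k] S)) : (slice c S).rTensor W w ∈ X.baseChange S := by
  obtain ⟨w, rfl⟩ := hw
  induction w with
  | zero => simp
  | add x y hx hy => rw [map_add, map_add]; exact add_mem hx hy
  | tmul s x =>
    rw [LinearMap.baseChange_tmul, LinearMap.rTensor_tmul]
    exact Submodule.tmul_mem_baseChange_of_mem _ x.2

variable {hN : N.IsNormal} {ρ} {V : Submodule k Q} {σ : G ⟶ GenLin k V}

lemma conj_mem_baseChange_operatorSpan {S : CommAlgCat.{u} k} {y : (GenLin k Q).obj S}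
    {g : G.obj S} (hy : (y, g) ∈ intertwiners hN ρ V σ S) {φ : Module.End k Q}
    (hφ : φ ∈ operatorSpan ρ) :
    val y * (1 ⊗ₜ[k] φ) * val y⁻¹ ∈ (operatorSpan ρ).baseChange S := by
  induction hφ using Submodule.span_induction with
  | mem φ hφ =>
    obtain ⟨T, n, c, rfl⟩ := hφ
    let i₁ : T ⟶ CommAlgCat.of k (T ⊗[k] S) :=
      CommAlgCat.ofHom Algebra.TensorProduct.includeLeft
    let i₂ : S ⟶ CommAlgCat.of k (T ⊗[k] S) :=
      CommAlgCat.ofHom Algebra.TensorProduct.includeRight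
    have h := hy.1 _ i₂ ⟨(G.map i₁).hom n.1, N.map_mem i₁ n.1 n.2⟩
    rw [← rTensor_slice_conj]
    refine rTensor_slice_mem_baseChange c ?_
    have e : extend i₂ (val y) * extend i₁ (op ρ n) * extend i₂ (val y⁻¹) =
        op ρ (conjPt hN ((G.map i₂).hom g) ⟨(G.map i₁).hom n.1, N.map_mem i₁ n.1 n.2⟩) := by
      have h' := congrArg val h
      rw [val_mul, val_mul] at h'
      rw [← op_map ρ i₁ n]
      refine (congrArg (· * extend i₂ (val y⁻¹)) h').trans ?_
      dsimp only
      rw [val_map, mul_assoc, ← map_mul, val_mul_val_inv, map_one, mul_one]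
      rfl
    have := op_mem_baseChange ρ
      (conjPt hN ((G.map i₂).hom g) ⟨(G.map i₁).hom n.1, N.map_mem i₁ n.1 n.2⟩)
    rw [← e] at this
    exact this
  | zero => simp
  | add a b _ _ ha hb =>
    rw [TensorProduct.tmul_add, mul_add, add_mul]
    exact add_mem ha hb
  | smul c a _ ha =>
    rw [TensorProduct.tmul_smul, mul_smul_comm, smul_mul_assoc, ← algebraMap_smul S c]
    exact Submodule.smul_mem _ _ ha

lemma act_mem_baseChange_of_mem_intertwiners {S : CommAlgCat.{u} k} {y : (GenLin k Q).obj S}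
    {g : G.obj S} (hy : (y, g) ∈ intertwiners hN ρ V σ S) {v : Q} (hv : v ∈ V) :
    act (val y) (1 ⊗ₜ[k] v) ∈ V.baseChange S := by
  have := hy.2 (1 ⊗ₜ[k] ⟨v, hv⟩)
  dsimp only at this
  rw [LinearMap.baseChange_tmul] at this
  exact ⟨_, this.symm⟩

end OperatorSpan

end KGroup

namespace KGroup

variable {k : Type u} [Field k]

/-! ### The quotient of the image by `U` -/

section Product

variable (F₁ F₂ : KGroup k)

/-- The product of two `k`-group functors. -/
def prod : KGroup k where
  obj S := GrpCat.of (F₁.obj S × F₂.obj S)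
  map f := GrpCat.ofHom ((F₁.map f).hom.prodMap (F₂.map f).hom)
  map_id _ := GrpCat.ext fun x => Prod.ext (map_id_apply x.1) (map_id_apply x.2)
  map_comp f g := GrpCat.ext fun x => Prod.ext (map_comp_apply f g x.1) (map_comp_apply f g x.2)

variable {F₁ F₂}

/-- The homomorphism to a product with given components. -/
def prodLift {F : KGroup k} (τ₁ : F ⟶ F₁) (τ₂ : F ⟶ F₂) : F ⟶ prod F₁ F₂ where
  app S := GrpCat.ofHom ((τ₁.app S).hom.prod (τ₂.app S).hom)
  naturality _ _ f := GrpCat.ext fun x => Prod.ext (app_map_apply τ₁ f x) (app_map_apply τ₂ f x)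

end Product

section Quotient

variable {G : KGroup k} {N : SubgroupFunctor G} {Q : Type u} [AddCommGroup Q] [Module k Q]
  {hN : N.IsNormal} {ρ : N.toKGroup ⟶ GenLin k Q} {V : Submodule k Q} {σ : G ⟶ GenLin k V}

/-- If a homomorphism into `GL(Q)` takes values in intertwiners, the quotient of its image by `U`
exists: the image acts on `V`, and by conjugation on the span `R` of the operators of `N`, and `U`
is the kernel of the resulting homomorphism to `GL(V) × GL(R)`. -/
lemma exists_isQuotient_image [FiniteDimensional k Q] {F : KGroup k} (h : F ⟶ GenLin k Q)
    (hF : F.IsAffineAlgebraic)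
    (hh : ∀ (S : CommAlgCat.{u} k) (x : F.obj S),
      ∃ g : G.obj S, ((h.app S).hom x, g) ∈ intertwiners hN ρ V σ S) :
    ∃ (H : KGroup k) (q : (SubgroupFunctor.image h).toKGroup ⟶ H), H.IsAffineAlgebraic ∧
      IsQuotient q ((unipotent ρ V).restrict (SubgroupFunctor.image h)) := by
  let Z := SubgroupFunctor.image h
  let R := operatorSpan ρ
  let a (S : CommAlgCat.{u} k) : (GenLin k Q).obj S →* Module.End S (S ⊗[k] Q) :=
    { toFun := fun y => act (val y)
      map_one' := by rw [val_one, map_one]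
      map_mul' := fun y z => by rw [val_mul, map_mul] }
  have ha : ∀ {S T : CommAlgCat.{u} k} (f : S ⟶ T) (y : (GenLin k Q).obj S) (w : S ⊗[k] Q),
      a T (((GenLin k Q).map f).hom y) (extendScalars Q f w) = extendScalars Q f (a S y w) :=
    fun f y w => act_extend f (val y) w
  let c (S : CommAlgCat.{u} k) :
      (GenLin k Q).obj S →* Module.End S (S ⊗[k] Module.End k Q) :=
    { toFun := fun y => LinearMap.mulRight S (val y⁻¹) ∘ₗ LinearMap.mulLeft S (val y)
      map_one' := LinearMap.ext fun w => by
        change val 1 * w * val 1⁻¹ = w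
        rw [inv_one, val_one, one_mul, mul_one]
      map_mul' := fun y z => LinearMap.ext fun w => by
        change val (y * z) * w * val (y * z)⁻¹ = val y * (val z * w * val z⁻¹) * val y⁻¹
        rw [mul_inv_rev, val_mul, val_mul]
        simp only [mul_assoc] }
  have hc : ∀ {S T : CommAlgCat.{u} k} (f : S ⟶ T) (y : (GenLin k Q).obj S)
      (w : S ⊗[k] Module.End k Q), c T (((GenLin k Q).map f).hom y)
        (extendScalars (Module.End k Q) f w) = extendScalars (Module.End k Q) f (c S y w) := by
    intro S T f y w
    change val _ * extend f w * val (((GenLin k Q).map f).hom y)⁻¹ = extend f (val y * w * val y⁻¹)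
    rw [← map_inv, val_map, val_map, map_mul, map_mul]
  have haV : ∀ (S : CommAlgCat.{u} k) (y : Z.toKGroup.obj S), ∀ v ∈ V,
      a S y.1 (1 ⊗ₜ[k] v) ∈ V.baseChange S := fun S y v hv =>
    mem_baseChange_of_mem_image V h ha (fun S x v hv => by
      obtain ⟨g, hg⟩ := hh S x
      exact act_mem_baseChange_of_mem_intertwiners hg hv) y.2 hv
  have hcR : ∀ (S : CommAlgCat.{u} k) (y : Z.toKGroup.obj S), ∀ φ ∈ R,
      c S y.1 (1 ⊗ₜ[k] φ) ∈ R.baseChange S := fun S y φ hφ =>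
    mem_baseChange_of_mem_image R h hc (fun S x φ hφ => by
      obtain ⟨g, hg⟩ := hh S x
      exact conj_mem_baseChange_operatorSpan hg hφ) y.2 hφ
  obtain ⟨τ₁, hτ₁⟩ := exists_hom_genLin (F := Z.toKGroup) V
    (a := fun S => (a S).comp (Z.pts S).subtype) (fun f y w => ha f y.1 w) haV
  obtain ⟨τ₂, hτ₂⟩ := exists_hom_genLin (F := Z.toKGroup) R
    (a := fun S => (c S).comp (Z.pts S).subtype) (fun f y w => hc f y.1 w) hcR
  let τ : Z.toKGroup ⟶ prod (GenLin k V) (GenLin k R) := prodLift τ₁ τ₂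
  obtain ⟨B, b, _, hb⟩ := exists_isUniversal_genLin k Q
  obtain ⟨B₁, b₁, _, hb₁⟩ := exists_isUniversal_genLin k V
  obtain ⟨B₂, b₂, _, hb₂⟩ := exists_isUniversal_genLin k R
  obtain ⟨b', hb'⟩ := exists_isUniversal_tensorProduct (F := prod (GenLin k V) (GenLin k R))
    (fun _ x => x.1) (fun _ x => x.2) (fun _ _ => rfl) (fun _ _ => rfl)
    (fun _ => Function.bijective_id) hb₁ hb₂
  have hZ : Z.toKGroup.IsAffineAlgebraic := image_isAffineAlgebraic h hb hF
  have : Algebra.FiniteType k (CommAlgCat.of k (B₁ ⊗[k] B₂)) :=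
    Algebra.FiniteType.trans (S := B₁) inferInstance inferInstance
  refine ⟨_, toImage τ, image_isAffineAlgebraic τ hb' hZ, fun S y => ?_,
    fun r r' hr => toImage_comorphism_injective τ hb' hZ hr⟩
  have e₁ := val_eq_one_iff V (hτ₁ S y)
  have e₂ := val_eq_one_iff R (hτ₂ S y)
  have e : ((toImage τ).app S).hom y = 1 ↔ (τ₁.app S).hom y = 1 ∧ (τ₂.app S).hom y = 1 :=
    Subtype.ext_iff.trans Prod.ext_iff
  rw [e, e₁, e₂]
  exact mem_unipotent_iff_act_eq.symm

end Quotient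

/-! ### The extension groups of two structure maps -/

namespace StructureMap

variable {G : KGroup k} {N : SubgroupFunctor G} {Q : Type u} [AddCommGroup Q] [Module k Q]
  {hN : N.IsNormal} {ρ : N.toKGroup ⟶ GenLin k Q} {V : Submodule k Q} {σ : G ⟶ GenLin k V}
  (α α' : StructureMap hN ρ V σ) {S : CommAlgCat.{u} k}

/-- Two intertwiners over the same point of `G` differ by an element of `U`. -/
lemma mul_inv_mem_unipotent {y z : (GenLin k Q).obj S} {g : G.obj S}
    (hy : (y, g) ∈ intertwiners hN ρ V σ S) (hz : (z, g) ∈ intertwiners hN ρ V σ S) :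
    y * z⁻¹ ∈ (unipotent ρ V).pts S := by
  refine (sub_one_mem_iff hN ρ V σ _).2 ?_
  have e : ((y, g) * (z, g)⁻¹ : (GenLin k Q).obj S × G.obj S) = (y * z⁻¹, 1) :=
    Prod.ext rfl (mul_inv_cancel g)
  rw [← e]
  exact mul_mem hy (inv_mem hz)

lemma diamondRep_mem_intertwiners (p : α.diamond.obj S) :
    ((α.diamondRep.app S).hom p, (α.diamondProj.app S).hom p) ∈ intertwiners hN ρ V σ S := by
  obtain ⟨u, g⟩ := p
  have e : ((u.1, 1) * (α.toFun S g, g) : (GenLin k Q).obj S × G.obj S) =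
      (u.1 * α.toFun S g, g) := Prod.ext rfl (one_mul _)
  have h := mul_mem ((sub_one_mem_iff hN ρ V σ _).1 u.2) (α.mem_intertwiners g)
  rw [e] at h
  exact h

variable {α} in
lemma diamond_ext {p q : α.diamond.obj S}
    (h : (α.diamondRep.app S).hom p = (α.diamondRep.app S).hom q)
    (h' : (α.diamondProj.app S).hom p = (α.diamondProj.app S).hom q) : p = q :=
  DiamondPts.eq_of h h'

/-- The point `(y α(g)⁻¹, g)` of `G^⋄` over an intertwiner `(y, g)`. -/
noncomputable def diamondPt {y : (GenLin k Q).obj S} {g : G.obj S}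
    (hy : (y, g) ∈ intertwiners hN ρ V σ S) : α.diamond.obj S :=
  DiamondPts.mk (α := α)
    ⟨y * (α.toFun S g)⁻¹, mul_inv_mem_unipotent hy (α.mem_intertwiners g)⟩ g

lemma diamondRep_diamondPt {y : (GenLin k Q).obj S} {g : G.obj S}
    (hy : (y, g) ∈ intertwiners hN ρ V σ S) : (α.diamondRep.app S).hom (α.diamondPt hy) = y :=
  inv_mul_cancel_right y (α.toFun S g)

lemma diamondProj_diamondPt {y : (GenLin k Q).obj S} {g : G.obj S}
    (hy : (y, g) ∈ intertwiners hN ρ V σ S) : (α.diamondProj.app S).hom (α.diamondPt hy) = g :=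
  rfl

/-- A pair of homomorphisms to `GL(Q)` and `G` which takes values in intertwiners factors through
`G^⋄`: on points, `G^⋄` is the group of all intertwiners. -/
noncomputable def diamondLift {F : KGroup k} (h : F ⟶ GenLin k Q) (t : F ⟶ G)
    (hF : ∀ (S : CommAlgCat.{u} k) (x : F.obj S),
      ((h.app S).hom x, (t.app S).hom x) ∈ intertwiners hN ρ V σ S) : F ⟶ α.diamond where
  app S := GrpCat.ofHom <| MonoidHom.mk' (G := α.diamond.obj S)
    (fun x => α.diamondPt (hF S x)) fun x y => diamond_ext
      (by rw [diamondRep_diamondPt, map_mul, map_mul, diamondRep_diamondPt, diamondRep_diamondPt])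
      (by rw [diamondProj_diamondPt, map_mul, map_mul, diamondProj_diamondPt,
        diamondProj_diamondPt])
  naturality S T f := GrpCat.ext fun x => by
    change α.diamondPt (hF T _) = (α.diamond.map f).hom (α.diamondPt (hF S x))
    refine diamond_ext ?_ ?_
    · rw [app_map_apply, diamondRep_diamondPt, diamondRep_diamondPt]
      exact app_map_apply h f x
    · rw [app_map_apply, diamondProj_diamondPt, diamondProj_diamondPt]
      exact app_map_apply t f x

lemma diamondLift_diamondRep {F : KGroup k} (h : F ⟶ GenLin k Q) (t : F ⟶ G)
    (hF : ∀ (S : CommAlgCat.{u} k) (x : F.obj S),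
      ((h.app S).hom x, (t.app S).hom x) ∈ intertwiners hN ρ V σ S) :
    α.diamondLift h t hF ≫ α.diamondRep = h := by
  ext S x
  exact α.diamondRep_diamondPt (hF S x)

lemma diamondLift_diamondProj {F : KGroup k} (h : F ⟶ GenLin k Q) (t : F ⟶ G)
    (hF : ∀ (S : CommAlgCat.{u} k) (x : F.obj S),
      ((h.app S).hom x, (t.app S).hom x) ∈ intertwiners hN ρ V σ S) :
    α.diamondLift h t hF ≫ α.diamondProj = t := rfl

variable {α} in
lemma hom_diamond_ext {F : KGroup k} {φ ψ : F ⟶ α.diamond}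
    (h₁ : φ ≫ α.diamondRep = ψ ≫ α.diamondRep) (h₂ : φ ≫ α.diamondProj = ψ ≫ α.diamondProj) :
    φ = ψ := by
  ext S x
  exact diamond_ext (ConcreteCategory.congr_hom (congr_app h₁ S) x)
    (ConcreteCategory.congr_hom (congr_app h₂ S) x)

/-- The extension groups of two structure maps are isomorphic, as both have the intertwiners as
their points. -/
noncomputable def diamondIso : α.diamond ≅ α'.diamond where
  hom := α'.diamondLift α.diamondRep α.diamondProj fun _ p => α.diamondRep_mem_intertwiners p
  inv := α.diamondLift α'.diamondRep α'.diamondProj fun _ p => α'.diamondRep_mem_intertwiners p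
  hom_inv_id := hom_diamond_ext
    (by rw [Category.assoc, diamondLift_diamondRep, diamondLift_diamondRep, Category.id_comp])
    (by rw [Category.assoc, diamondLift_diamondProj, diamondLift_diamondProj, Category.id_comp])
  inv_hom_id := hom_diamond_ext
    (by rw [Category.assoc, diamondLift_diamondRep, diamondLift_diamondRep, Category.id_comp])
    (by rw [Category.assoc, diamondLift_diamondProj, diamondLift_diamondProj, Category.id_comp])

lemma image_diamondRep_eq :
    SubgroupFunctor.image α.diamondRep = SubgroupFunctor.image α'.diamondRep := by
  have key : ∀ α α' : StructureMap hN ρ V σ, ∀ r, VanishesOn α.diamondRep r →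
      VanishesOn α'.diamondRep r := by
    intro α α' r hr T p
    rw [← α.diamondRep_diamondPt (α'.diamondRep_mem_intertwiners p)]
    exact hr T _
  refine SubgroupFunctor.ext (funext fun S => Subgroup.ext fun y => ?_)
  rw [mem_image_iff, mem_image_iff]
  exact ⟨fun h r hr => h r (key α' α r hr), fun h r hr => h r (key α α' r hr)⟩

lemma diamond_isAffineAlgebraic [FiniteDimensional k Q] (hG : G.IsAffineAlgebraic)
    (hsoc : socle ρ ≤ V) : α.diamond.IsAffineAlgebraic := by
  obtain ⟨A, g, _, _, hg⟩ := hG.exists_isUniversal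
  obtain ⟨d, u, hu⟩ := exists_isUniversal_unipotent ρ V fun S x hx =>
    isNilpotent_of_mem_annihilator_baseChange hsoc hx
  obtain ⟨x, hx⟩ := exists_isUniversal_tensorProduct (F := α.diamond)
    (fun _ p => DiamondPts.g p) (fun _ p => DiamondPts.u p) (fun _ _ => rfl) (fun _ _ => rfl)
    (fun S => ⟨fun p q h => DiamondPts.ext (Prod.ext_iff.1 h).2 (Prod.ext_iff.1 h).1,
      fun ⟨g, u⟩ => ⟨⟨u, g⟩, rfl⟩⟩) hg hu
  have : Algebra.FiniteType k (CommAlgCat.of k (A ⊗[k] MvPolynomial (Fin d) k)) :=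
    Algebra.FiniteType.trans (S := A) inferInstance inferInstance
  have : IsReduced (CommAlgCat.of k (A ⊗[k] MvPolynomial (Fin d) k)) :=
    isReduced_of_injective (MvPolynomial.algebraTensorAlgEquiv k A)
      (MvPolynomial.algebraTensorAlgEquiv k A).injective
  exact hx.isAffineAlgebraic

/-- The point `(u, g)` of `G^⋄`, for `u ∈ U(S)` and `g ∈ G(S)`. -/
def mkPt (u : (unipotent ρ V).pts S) (g : G.obj S) : α.diamond.obj S :=
  (⟨u, g⟩ : α.DiamondPts S)

lemma diamondRep_mkPt (u : (unipotent ρ V).pts S) (g : G.obj S) :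
    (α.diamondRep.app S).hom (α.mkPt u g) = u.1 * α.toFun S g := rfl

lemma toFun_mem_image (g : G.obj S) :
    α.toFun S g ∈ (SubgroupFunctor.image α.diamondRep).pts S := by
  have h := app_mem_image α.diamondRep (α.mkPt 1 g)
  rwa [diamondRep_mkPt, OneMemClass.coe_one, one_mul] at h

lemma unipotent_le_image : (unipotent ρ V).Le (SubgroupFunctor.image α.diamondRep) := by
  intro S u hu
  have h := app_mem_image α.diamondRep (α.mkPt ⟨u, hu⟩ 1)
  rwa [diamondRep_mkPt, α.map_one, mul_one] at h

end StructureMap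

/-! ### The homomorphism to the quotient and the pullback square -/

section Square

variable {G : KGroup k} {N : SubgroupFunctor G} {Q : Type u} [AddCommGroup Q] [Module k Q]
  {hN : N.IsNormal} {ρ : N.toKGroup ⟶ GenLin k Q} {V : Submodule k Q} {σ : G ⟶ GenLin k V}

lemma IsQuotient.app_eq_app_iff {F H : KGroup k} {q : F ⟶ H} {U : SubgroupFunctor F}
    (hq : IsQuotient q U) {S : CommAlgCat.{u} k} {x y : F.obj S} :
    (q.app S).hom x = (q.app S).hom y ↔ x * y⁻¹ ∈ U.pts S := by
  rw [← hq.ker_eq, map_mul, map_inv, mul_inv_eq_one]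

variable {Z : SubgroupFunctor (GenLin k Q)} {H : KGroup k} {q : Z.toKGroup ⟶ H}

lemma IsQuotient.app_eq_app_of_intertwiners (hq : IsQuotient q ((unipotent ρ V).restrict Z))
    {S : CommAlgCat.{u} k} {y z : Z.toKGroup.obj S} {g : G.obj S}
    (hy : (y.1, g) ∈ intertwiners hN ρ V σ S) (hz : (z.1, g) ∈ intertwiners hN ρ V σ S) :
    (q.app S).hom y = (q.app S).hom z :=
  hq.app_eq_app_iff.2 (StructureMap.mul_inv_mem_unipotent hy hz)

/-- Points of `Z` with the same image in `Z/U` intertwine over the same points of `G`. -/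
lemma IsQuotient.mem_intertwiners (hq : IsQuotient q ((unipotent ρ V).restrict Z))
    {S : CommAlgCat.{u} k} {y z : Z.toKGroup.obj S} {g : G.obj S}
    (hz : (z.1, g) ∈ intertwiners hN ρ V σ S) (h : (q.app S).hom y = (q.app S).hom z) :
    (y.1, g) ∈ intertwiners hN ρ V σ S := by
  have hu : y.1 * z.1⁻¹ ∈ (unipotent ρ V).pts S := hq.app_eq_app_iff.1 h
  have e : ((y.1 * z.1⁻¹, 1) * (z.1, g) : (GenLin k Q).obj S × G.obj S) = (y.1, g) :=
    Prod.ext (inv_mul_cancel_right _ _) (one_mul g)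
  rw [← e]
  exact mul_mem ((sub_one_mem_iff hN ρ V σ _).1 hu) hz

namespace StructureMap

variable (α : StructureMap hN ρ V σ)

/-- The value `α(g)` as a point of a subgroup `Z` of `GL(Q)` containing the values of `α`. -/
def toSubgroup (hα : ∀ (S : CommAlgCat.{u} k) (g : G.obj S), α.toFun S g ∈ Z.pts S)
    {S : CommAlgCat.{u} k} (g : G.obj S) : Z.toKGroup.obj S :=
  ⟨α.toFun S g, hα S g⟩

/-- The homomorphism `G → Z/U`, `g ↦ α(g) U`, for a subgroup `Z` of `GL(Q)` containing the values
of the structure map `α`. -/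
noncomputable def toQuotient (hq : IsQuotient q ((unipotent ρ V).restrict Z))
    (hα : ∀ (S : CommAlgCat.{u} k) (g : G.obj S), α.toFun S g ∈ Z.pts S) : G ⟶ H where
  app S := GrpCat.ofHom <| MonoidHom.mk' (fun g => (q.app S).hom (α.toSubgroup hα g)) fun g h => by
    rw [← map_mul]
    exact hq.app_eq_app_of_intertwiners (α.mem_intertwiners (g * h))
      (mul_mem (α.mem_intertwiners g) (α.mem_intertwiners h))
  naturality S T f := GrpCat.ext fun g => by
    refine Eq.trans ?_ (app_map_apply q f (α.toSubgroup hα g))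
    exact congrArg (q.app T).hom (Subtype.ext (α.naturality f g))

lemma toQuotient_app (hq : IsQuotient q ((unipotent ρ V).restrict Z))
    (hα : ∀ (S : CommAlgCat.{u} k) (g : G.obj S), α.toFun S g ∈ Z.pts S)
    {S : CommAlgCat.{u} k} {y : Z.toKGroup.obj S} {g : G.obj S}
    (hy : (y.1, g) ∈ intertwiners hN ρ V σ S) :
    ((α.toQuotient hq hα).app S).hom g = (q.app S).hom y :=
  hq.app_eq_app_of_intertwiners (α.mem_intertwiners g) hy

/-- A pair `(g, y)` of points of `G` and `Z` has the same image in `Z/U` if and only if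
`y α(g)⁻¹ ∈ U`, that is, if and only if it comes from the point `(y α(g)⁻¹, g)` of `G^⋄`. The
homomorphism `G → Z/U` may be defined by another structure map `α'`. -/
lemma isPullback (α' : StructureMap hN ρ V σ) (hq : IsQuotient q ((unipotent ρ V).restrict Z))
    (hα : ∀ (S : CommAlgCat.{u} k) (x : α.diamond.obj S), (α.diamondRep.app S).hom x ∈ Z.pts S)
    (hα' : ∀ (S : CommAlgCat.{u} k) (g : G.obj S), α'.toFun S g ∈ Z.pts S) :
    IsPullback α.diamondProj (Z.lift α.diamondRep hα) (α'.toQuotient hq hα') q := by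
  have w : α.diamondProj ≫ α'.toQuotient hq hα' = Z.lift α.diamondRep hα ≫ q := by
    ext S p
    exact α'.toQuotient_app hq hα' (α.diamondRep_mem_intertwiners p)
  have hF : ∀ (s : Limits.PullbackCone (α'.toQuotient hq hα') q) (S : CommAlgCat.{u} k)
      (x : s.pt.obj S), (((s.snd ≫ Z.ι).app S).hom x, (s.fst.app S).hom x) ∈
        intertwiners hN ρ V σ S := fun s S x =>
    hq.mem_intertwiners (α'.mem_intertwiners _)
      (ConcreteCategory.congr_hom (congr_app s.condition S) x).symm
  refine ⟨⟨w⟩, ⟨Limits.PullbackCone.IsLimit.mk w (fun s => α.diamondLift (s.snd ≫ Z.ι) s.fst (hF s))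
    (fun s => α.diamondLift_diamondProj _ _ _) (fun s => ?_) (fun s m h₁ h₂ => ?_)⟩⟩
  · ext S x
    exact Subtype.ext (α.diamondRep_diamondPt (hF s S x))
  · refine hom_diamond_ext ?_ ?_
    · rw [diamondLift_diamondRep, ← h₂]; rfl
    · rw [diamondLift_diamondProj, h₁]

end StructureMap

end Square

end KGroup

theorem theorem3p6 {k : Type u} [Field k] [IsAlgClosed k]
    (G : KGroup k) (hG : G.IsAffineAlgebraic)
    (N : KGroup.SubgroupFunctor G) (hNc : N.IsClosed) (hN : N.IsNormal)
    (Q : Type u) [AddCommGroup Q] [Module k Q] [FiniteDimensional k Q]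
    (ρ : N.toKGroup ⟶ KGroup.GenLin k Q)
    (V : Submodule k Q) (σ : G ⟶ KGroup.GenLin k V) (hV : KGroup.IsGSubmodule ρ V σ)
    (hsoc : KGroup.socle ρ ≤ V)
    -- the pair `(Q, V)` is strongly `G`-stable
    (hstable : Nonempty (KGroup.StructureMap hN ρ V σ)) :
    ∃ Gs : KGroup.SubgroupFunctor (KGroup.GenLin k Q),
      -- `G^*` is an affine algebraic group, closed in `GL_k(Q)` and containing `U`
      Gs.IsClosed ∧ Gs.toKGroup.IsAffineAlgebraic ∧ (KGroup.unipotent ρ V).Le Gs ∧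
      -- for every choice of `α`, `G^⋄` is an affine algebraic group, and the image `U α(G)` of
      -- `ρ^⋄` (as a closed subgroup scheme, and on `k`-points) is `G^*`
      (∀ α : KGroup.StructureMap hN ρ V σ,
        α.diamond.IsAffineAlgebraic ∧
        KGroup.SubgroupFunctor.image α.diamondRep = Gs ∧
        ∀ y : (KGroup.GenLin k Q).obj (CommAlgCat.of k k),
          y ∈ Gs.pts (CommAlgCat.of k k) ↔
            ∃ u ∈ (KGroup.unipotent ρ V).pts (CommAlgCat.of k k),
              ∃ g : G.obj (CommAlgCat.of k k), y = u * α.toFun (CommAlgCat.of k k) g) ∧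
      -- the quotient `G^*/U` exists as an affine algebraic group
      (∃ (H : KGroup k) (q : Gs.toKGroup ⟶ H), H.IsAffineAlgebraic ∧
        KGroup.IsQuotient q ((KGroup.unipotent ρ V).restrict Gs)) ∧
      -- for `H = G^*/U` there is one homomorphism `θ : G → G^*/U` which, for every choice of `α`,
      -- is `g ↦ α(g) U` and makes the square with corners `G^⋄, G, G^*, G^*/U` a pullback
      (∀ (H : KGroup k) (q : Gs.toKGroup ⟶ H), H.IsAffineAlgebraic →
        KGroup.IsQuotient q ((KGroup.unipotent ρ V).restrict Gs) →
        ∃ θ : G ⟶ H, ∀ α : KGroup.StructureMap hN ρ V σ,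
          (∀ (S : CommAlgCat.{u} k) (g : G.obj S), ∃ y : Gs.pts S,
            y.1 = α.toFun S g ∧ (θ.app S).hom g = (q.app S).hom y) ∧
          ∃ p : α.diamond ⟶ Gs.toKGroup, p ≫ Gs.ι = α.diamondRep ∧
            IsPullback α.diamondProj p θ q) ∧
      -- `G^⋄` is independent of `α` up to an isomorphism preserving the action on `Q` (and the
      -- projection to `G`)
      (∀ α α' : KGroup.StructureMap hN ρ V σ, ∃ φ : α.diamond ≅ α'.diamond,
        φ.hom ≫ α'.diamondRep = α.diamondRep ∧ φ.hom ≫ α'.diamondProj = α.diamondProj) := by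
  obtain ⟨α₀⟩ := hstable
  obtain ⟨B, b, _, hb⟩ := KGroup.exists_isUniversal_genLin k Q
  have hD : ∀ α : KGroup.StructureMap hN ρ V σ, α.diamond.IsAffineAlgebraic :=
    fun α => α.diamond_isAffineAlgebraic hG hsoc
  have himg : ∀ α : KGroup.StructureMap hN ρ V σ,
      KGroup.SubgroupFunctor.image α.diamondRep = KGroup.SubgroupFunctor.image α₀.diamondRep :=
    fun α => α.image_diamondRep_eq α₀
  refine ⟨KGroup.SubgroupFunctor.image α₀.diamondRep, KGroup.image_isClosed _,
    KGroup.image_isAffineAlgebraic _ hb (hD α₀), α₀.unipotent_le_image,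
    fun α => ⟨hD α, himg α, fun y => ?_⟩, ?_, fun H q _ hq => ?_, fun α α' => ?_⟩
  · rw [← himg α]
    constructor
    · intro hy
      obtain ⟨⟨u, g⟩, rfl⟩ := KGroup.exists_toImage_eq α.diamondRep hb (hD α) hy
      exact ⟨u.1, u.2, g, rfl⟩
    · rintro ⟨u, hu, g, rfl⟩
      exact KGroup.app_mem_image α.diamondRep (α.mkPt ⟨u, hu⟩ g)
  · exact KGroup.exists_isQuotient_image α₀.diamondRep (hD α₀) fun S p =>
      ⟨_, α₀.diamondRep_mem_intertwiners p⟩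
  · have hmem : ∀ (α : KGroup.StructureMap hN ρ V σ) (S : CommAlgCat.{u} k) (p : α.diamond.obj S),
        (α.diamondRep.app S).hom p ∈ (KGroup.SubgroupFunctor.image α₀.diamondRep).pts S :=
      fun α S p => himg α ▸ KGroup.app_mem_image α.diamondRep p
    have hα : ∀ (α : KGroup.StructureMap hN ρ V σ) (S : CommAlgCat.{u} k) (g : G.obj S),
        α.toFun S g ∈ (KGroup.SubgroupFunctor.image α₀.diamondRep).pts S :=
      fun α S g => himg α ▸ α.toFun_mem_image g
    exact ⟨α₀.toQuotient hq (hα α₀), fun α =>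
      ⟨fun S g => ⟨α.toSubgroup (hα α) g, rfl,
          α₀.toQuotient_app hq (hα α₀) (α.mem_intertwiners g)⟩,
        _, rfl, α.isPullback α₀ hq (hmem α) (hα α₀)⟩⟩
  · exact ⟨α.diamondIso α', α'.diamondLift_diamondRep _ _ _, α'.diamondLift_diamondProj _ _ _⟩
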